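/- Let $n\ge 2$ and let $G$ be a finite connected graph on the vertex set $[n]=\{1,\dots,n\}$ (multiple edges allowed, no loops) whose edges are directed from the smaller to the larger vertex, such that every inner vertex $v\in\{2,\dots,n-1\}$ has both an incoming and an outgoing edge. Fix a planar drawing of $G$ in which the vertices $1,\dots,n$ lie on a horizontal line in this order and the edges are $x$-monotone curves that meet each other and the vertices only at their common ends. Let $\mathcal F_G\subset\mathbb R^{E(G)}$ be the polytope of flows of size one: nonnegative functions on the edges, with total outflow $1$ at vertex $1$, total inflow $1$ at vertex $n$, and inflow equal to outflow at every inner vertex. Let $P_G$ be the set of bounded regions of the drawing, ordered by the reflexive transitive closure of: $A\le B$ if some edge of $G$ has $A$ directly below it and $B$ directly above it. Let $\mathcal O(P_G)$ be its order polytope, the set of order-preserving functions $P_G\to[0,1]$. The canonical triangulation of $\mathcal O(P_G)$ consists of the simplices $\Delta_a=\{x\in[0,1]^{P_G}: x(a_1)\le\dots\le x(a_m)\}$ for the linear extensions $a=(a_1,\dots,a_m)$ of $P_G$, together with their nonempty faces. A route is a directed path from $1$ to $n$; its vertex in $\mathcal F_G$ is the unit flow along it. In the planar framing, the incoming edges and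 the outgoing edges of each inner vertex are each linearly ordered from top to bottom. Two paths ending at the same inner vertex are compared through the edges by which they enter the maximal final part that they have in common, and two paths starting at the same inner vertex through the edges by which they leave their maximal common initial part. Two routes $P,Q$ are coherent if for every common inner vertex $v$ the parts of $P$ and $Q$ before $v$ and the parts after $v$ are ordered in the same way (weakly: equal parts are compatible with either order). A clique is a set of pairwise coherent routes. The Danilov–Karzanov–Koshevoy triangulation of $\mathcal F_G$ for this framing consists of the convex hulls of the vertices of the routes in the nonempty cliques; its top dimensional simplices come from the maximal cliques. Then $P_G$ is a finite poset, and every bounded region $A$ can be reached from the unbounded region below the drawing by an upward path in the dual graph, that is, a sequence of regions, bounded after the first, each lying directly above an edge of $G$ which has the preceding region directly below it. For each $A$ fix such a path. Then the linear map $\Phi$ that sends $fl$ to the function $A\mapsto\sum_e fl(e)$, the sum being over the edges $e$ crossed by the path of $A$, restricts to a bijection $\mathcal F_G\to\mathcal O(P_G)$, and under $\Phi$ the Danilov–Karzanov–Koshevoy triangulation of $\mathcal F_G$ for the planar framing is equal to the canonical triangulation of $\mathcal O(P_G)$: the images of the simplices of the former are exactly the simplices of the latter, and likewise for the top dimensional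 simplices. -/

import Mathlib

open Set Filter Topology

/-! ### Graphs and flow polytopes -/

/-- A finite directed multigraph on the `n + 2 ≥ 2` linearly ordered vertices
`0 < 1 < ⋯ < n + 1`, with edges labelled by `E` and directed from the smaller to the larger
end. Parallel edges are allowed, loops are not. -/
structure FlowGraph (n : ℕ) (E : Type*) where
  /-- the initial (smaller) vertex of an edge -/
  src : E → Fin (n + 2)
  /-- the final (larger) vertex of an edge -/
  tgt : E → Fin (n + 2)
  src_lt_tgt : ∀ e, src e < tgt e

namespace FlowGraph

variable {n : ℕ} {E : Type*} (G : FlowGraph n E)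

/-- The underlying undirected graph is connected. -/
def Connected : Prop :=
  (SimpleGraph.fromRel fun u v : Fin (n + 2) => ∃ e, G.src e = u ∧ G.tgt e = v).Connected

/-- Inner vertices: all vertices except the source `0` and the sink `n + 1`. -/
def IsInner (_G : FlowGraph n E) (v : Fin (n + 2)) : Prop := v ≠ 0 ∧ v ≠ Fin.last (n + 1)

/-- The polytope of flows of size one. -/
def flowPolytope [Fintype E] : Set (E → ℝ) :=
  {fl | (∀ e, 0 ≤ fl e) ∧
    ∑ e with G.src e = 0, fl e = 1 ∧
    ∑ e with G.tgt e = Fin.last (n + 1), fl e = 1 ∧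
    ∀ v, G.IsInner v → ∑ e with G.tgt e = v, fl e = ∑ e with G.src e = v, fl e}

/-- `G.IsPath u v p`: the list of edges `p` is a directed path from `u` to `v`. -/
def IsPath : Fin (n + 2) → Fin (n + 2) → List E → Prop
  | u, v, [] => u = v
  | u, v, e :: p => G.src e = u ∧ IsPath (G.tgt e) v p

/-- Routes: directed paths from the source to the sink. -/
def IsRoute (p : List E) : Prop := G.IsPath 0 (Fin.last (n + 1)) p

/-- The unit flow along a route. -/
noncomputable def routeFlow (_G : FlowGraph n E) (p : List E) : E → ℝ :=
  Set.indicator {e | e ∈ p} 1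

/-! ### Framings, cliques and the Danilov–Karzanov–Koshevoy triangulation -/

/-- A framing: at each inner vertex, a linear order on the incoming edges and a linear order on
the outgoing edges. -/
structure Framing where
  /-- `inLT v e f`: `e` precedes `f` among the incoming edges of `v` -/
  inLT : Fin (n + 2) → E → E → Prop
  /-- `outLT v e f`: `e` precedes `f` among the outgoing edges of `v` -/
  outLT : Fin (n + 2) → E → E → Prop
  in_linear : ∀ v, G.IsInner v →
    IsStrictTotalOrder {e // G.tgt e = v} (fun e f => inLT v e.1 f.1)
  out_linear : ∀ v, G.IsInner v →
    IsStrictTotalOrder {e // G.src e = v} (fun e f => outLT v e.1 f.1)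

namespace Framing

variable {G} (φ : G.Framing)

/-- The order on paths ending in a common vertex: `s` is the part after which the two paths
coincide, and `e`, `f` are the distinct edges through which they enter it. -/
def InLT (p q : List E) : Prop :=
  ∃ p' q' s e f, p = p' ++ e :: s ∧ q = q' ++ f :: s ∧
    G.tgt e = G.tgt f ∧ φ.inLT (G.tgt e) e f

/-- The order on paths starting at a common vertex: `s` is the part up to which the two paths
coincide, and `e`, `f` are the distinct edges through which they leave it. -/
def OutLT (p q : List E) : Prop :=
  ∃ p' q' s e f, p = s ++ e :: p' ∧ q = s ++ f :: q' ∧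
    G.src e = G.src f ∧ φ.outLT (G.src e) e f

/-- Weak version of `InLT`. -/
def InLE (p q : List E) : Prop := p = q ∨ φ.InLT p q

/-- Weak version of `OutLT`. -/
def OutLE (p q : List E) : Prop := p = q ∨ φ.OutLT p q

/-- Two routes are coherent if, at each common inner vertex `v`, their parts `p₁`, `q₁` before `v`
are ordered in the same way as their parts `p₂`, `q₂` after `v`. -/
def Coherent (p q : List E) : Prop :=
  ∀ v, G.IsInner v → ∀ p₁ p₂ q₁ q₂, p = p₁ ++ p₂ → q = q₁ ++ q₂ →
    G.IsPath 0 v p₁ → G.IsPath v (Fin.last (n + 1)) p₂ →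
    G.IsPath 0 v q₁ → G.IsPath v (Fin.last (n + 1)) q₂ →
    (φ.InLE p₁ q₁ ∧ φ.OutLE p₂ q₂) ∨ (φ.InLE q₁ p₁ ∧ φ.OutLE q₂ p₂)

/-- Cliques: sets of mutually coherent routes. -/
def IsClique (C : Set (List E)) : Prop :=
  (∀ p ∈ C, G.IsRoute p) ∧ ∀ p ∈ C, ∀ q ∈ C, φ.Coherent p q

/-- The top dimensional simplices of the Danilov–Karzanov–Koshevoy triangulation: convex hulls of
the vertices corresponding to the routes of a maximal clique. -/
def dkkTopSimplices : Set (Set (E → ℝ)) :=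
  {s | ∃ C, Maximal φ.IsClique C ∧ s = convexHull ℝ (G.routeFlow '' C)}

/-- The Danilov–Karzanov–Koshevoy triangulation, as the set of all its (nonempty) simplices:
convex hulls of the vertices corresponding to the routes of a nonempty clique. -/
def dkkTriangulation : Set (Set (E → ℝ)) :=
  {s | ∃ C, φ.IsClique C ∧ C.Nonempty ∧ s = convexHull ℝ (G.routeFlow '' C)}

end Framing

/-! ### Planar drawings -/

/-- A planar drawing of `G`, with the vertices on a horizontal line in their order and with the
edges drawn as `x`-monotone curves, that is, as graphs of continuous functions. -/
structure PlanarDrawing where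
  /-- the vertex `v` is drawn at the point `(pos v, 0)` -/
  pos : Fin (n + 2) → ℝ
  pos_strictMono : StrictMono pos
  /-- the edge `e` is drawn as the graph of `curve e` over `[pos (src e), pos (tgt e)]` -/
  curve : E → ℝ → ℝ
  continuousOn_curve : ∀ e, ContinuousOn (curve e) (Icc (pos (G.src e)) (pos (G.tgt e)))
  curve_src : ∀ e, curve e (pos (G.src e)) = 0
  curve_tgt : ∀ e, curve e (pos (G.tgt e)) = 0
  curve_ne_vertex : ∀ e v, pos v ∈ Ioo (pos (G.src e)) (pos (G.tgt e)) → curve e (pos v) ≠ 0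
  curve_ne_curve : ∀ e f, e ≠ f → ∀ x, x ∈ Ioo (pos (G.src e)) (pos (G.tgt e)) →
    x ∈ Ioo (pos (G.src f)) (pos (G.tgt f)) → curve e x ≠ curve f x

end FlowGraph

/-! ### Order polytopes and their canonical triangulation -/

/-- The order polytope of a poset. -/
def orderPolytope (P : Type*) [Preorder P] : Set (P → ℝ) :=
  {x | (∀ a, 0 ≤ x a ∧ x a ≤ 1) ∧ ∀ a b, a ≤ b → x a ≤ x b}

/-- Linear extensions of a finite poset: enumerations of its elements in which smaller elements
come first. -/
structure PosetLinearExtension (P : Type*) [Preorder P] where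
  /-- the enumeration -/
  enum : Fin (Nat.card P) ≃ P
  le_of_le : ∀ i j, enum i ≤ enum j → i ≤ j

/-- The simplex of a linear extension. -/
def PosetLinearExtension.simplex {P : Type*} [Preorder P] (a : PosetLinearExtension P) :
    Set (P → ℝ) :=
  {x | (∀ t, 0 ≤ x t ∧ x t ≤ 1) ∧ ∀ i j, i ≤ j → x (a.enum i) ≤ x (a.enum j)}

/-- The top dimensional simplices of the canonical triangulation of the order polytope. -/
def canonicalTopSimplices (P : Type*) [Preorder P] : Set (Set (P → ℝ)) :=
  {s | ∃ a : PosetLinearExtension P, s = a.simplex}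

/-- The canonical triangulation of the order polytope, as the set of all its (nonempty) simplices:
the faces of the top dimensional ones, each of them spanned by a set of vertices. -/
def canonicalTriangulation (P : Type*) [Preorder P] : Set (Set (P → ℝ)) :=
  {s | ∃ a : PosetLinearExtension P, ∃ V ⊆ a.simplex.extremePoints ℝ,
    V.Nonempty ∧ s = convexHull ℝ V}

namespace FlowGraph.PlanarDrawing

variable {n : ℕ} {E : Type*} {G : FlowGraph n E} (D : G.PlanarDrawing)

/-! ### The regions of a drawing and the poset of bounded regions -/

/-- The set of points of the plane that are covered by the drawing. -/
def support : Set (ℝ × ℝ) :=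
  {p | (∃ v, p = (D.pos v, 0)) ∨
    ∃ e, p.1 ∈ Icc (D.pos (G.src e)) (D.pos (G.tgt e)) ∧ p.2 = D.curve e p.1}

/-- The regions: connected components of the complement of the drawing. -/
def regions : Set (Set (ℝ × ℝ)) :=
  {R | ∃ p ∈ D.supportᶜ, R = connectedComponentIn D.supportᶜ p}

/-- `R` borders the edge `e` from below: at some interior point of `e`, the points just below
lie in `R`. -/
def BordersBelow (R : Set (ℝ × ℝ)) (e : E) : Prop :=
  ∃ x ∈ Ioo (D.pos (G.src e)) (D.pos (G.tgt e)), ∀ᶠ y in 𝓝[<] (D.curve e x), (x, y) ∈ R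

/-- `R` borders the edge `e` from above: at some interior point of `e`, the points just above
lie in `R`. -/
def BordersAbove (R : Set (ℝ × ℝ)) (e : E) : Prop :=
  ∃ x ∈ Ioo (D.pos (G.src e)) (D.pos (G.tgt e)), ∀ᶠ y in 𝓝[>] (D.curve e x), (x, y) ∈ R

/-- The bounded regions: the vertices of the truncated dual graph and the elements of the
poset `P_G`. -/
def BoundedRegion : Type := {R : Set (ℝ × ℝ) // R ∈ D.regions ∧ Bornology.IsBounded R}

/-- The dual edge of `e` in the truncated dual graph, directed from the bounded region `A` below
`e` to the bounded region `B` above `e`. -/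
def DualEdge (e : E) (A B : D.BoundedRegion) : Prop :=
  D.BordersBelow A.1 e ∧ D.BordersAbove B.1 e

/-- The order of `P_G`, generated by the edges of the truncated dual graph. -/
instance : Preorder D.BoundedRegion where
  le := Relation.ReflTransGen fun A B => ∃ e, D.DualEdge e A B
  le_refl _ := Relation.ReflTransGen.refl
  le_trans _ _ _ := Relation.ReflTransGen.trans

/-! ### The linear map between the polytopes -/

/-- `D.IsLowPath A l`: there is an upward directed path in the dual graph from the low point,
which represents the unbounded region below the drawing, to the bounded region `A`, and `l` is
the list of the edges of `G` that it crosses, the last one first. -/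
inductive IsLowPath : D.BoundedRegion → List E → Prop
  | start (R : Set (ℝ × ℝ)) (e : E) (A : D.BoundedRegion) :
      R ∈ D.regions → ¬ Bornology.IsBounded R → D.BordersBelow R e → D.BordersAbove A.1 e →
      IsLowPath A [e]
  | step (A B : D.BoundedRegion) (e : E) (l : List E) :
      IsLowPath A l → D.DualEdge e A B → IsLowPath B (e :: l)

/-- A choice of a fixed dual path between the low point and each bounded region. -/
def LowPaths : Type _ := ∀ A : D.BoundedRegion, {l : List E // D.IsLowPath A l}

/-- The linear map from flows to functions on the poset: the value at a region is the total flow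
through the edges crossed by the fixed dual path. -/
def flowToOrder (c : D.LowPaths) : (E → ℝ) →ₗ[ℝ] (D.BoundedRegion → ℝ) where
  toFun fl A := ((c A).1.map fl).sum
  map_add' f g := by
    funext A
    exact List.sum_map_add (f := f) (g := g)
  map_smul' r f := by
    funext A
    exact List.sum_map_mul_left (l := (c A).1) (f := f) (r := r)

/-! ### The planar framing -/

/-- Continuous functions that agree nowhere on an interval are comparable on it. -/
theorem lt_or_lt_of_ne {a b : ℝ} {f g : ℝ → ℝ} (hf : ContinuousOn f (Ioo a b))
    (hg : ContinuousOn g (Ioo a b)) (h : ∀ x ∈ Ioo a b, f x ≠ g x) :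
    (∀ x ∈ Ioo a b, f x < g x) ∨ ∀ x ∈ Ioo a b, g x < f x := by
  by_contra! hc
  obtain ⟨⟨x, hx, hx'⟩, y, hy, hy'⟩ := hc
  obtain ⟨z, hz, hz'⟩ := isPreconnected_Ioo.intermediate_value₂ hy hx hf hg hy' hx'
  exact h z hz hz'

/-- `e` arrives at its final vertex above `f`. -/
def AboveIn (v : Fin (n + 2)) (e f : E) : Prop := ∀ᶠ x in 𝓝[<] (D.pos v), D.curve f x < D.curve e x

/-- `e` leaves its initial vertex above `f`. -/
def AboveOut (v : Fin (n + 2)) (e f : E) : Prop := ∀ᶠ x in 𝓝[>] (D.pos v), D.curve f x < D.curve e x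

theorem aboveIn_total {v : Fin (n + 2)} {e f : E} (he : G.tgt e = v) (hf : G.tgt f = v)
    (hne : e ≠ f) : D.AboveIn v e f ∨ D.AboveIn v f e := by
  have h1 : D.pos (G.src e) < D.pos v := D.pos_strictMono (he ▸ G.src_lt_tgt e)
  have h2 : D.pos (G.src f) < D.pos v := D.pos_strictMono (hf ▸ G.src_lt_tgt f)
  have hI : Ioo (max (D.pos (G.src e)) (D.pos (G.src f))) (D.pos v) ∈ 𝓝[<] (D.pos v) :=
    Ioo_mem_nhdsLT (max_lt h1 h2)
  have ce := D.continuousOn_curve e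
  have cf := D.continuousOn_curve f
  have hn := D.curve_ne_curve f e hne.symm
  rw [he] at ce hn
  rw [hf] at cf hn
  rcases lt_or_lt_of_ne (a := max (D.pos (G.src e)) (D.pos (G.src f))) (b := D.pos v)
      (cf.mono fun x hx => ⟨((le_max_right _ _).trans_lt hx.1).le, hx.2.le⟩)
      (ce.mono fun x hx => ⟨((le_max_left _ _).trans_lt hx.1).le, hx.2.le⟩)
      (fun x hx => hn x ⟨(le_max_right _ _).trans_lt hx.1, hx.2⟩
        ⟨(le_max_left _ _).trans_lt hx.1, hx.2⟩) with h | h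
  · exact Or.inl (mem_of_superset hI h)
  · exact Or.inr (mem_of_superset hI h)

theorem aboveOut_total {v : Fin (n + 2)} {e f : E} (he : G.src e = v) (hf : G.src f = v)
    (hne : e ≠ f) : D.AboveOut v e f ∨ D.AboveOut v f e := by
  have h1 : D.pos v < D.pos (G.tgt e) := D.pos_strictMono (he ▸ G.src_lt_tgt e)
  have h2 : D.pos v < D.pos (G.tgt f) := D.pos_strictMono (hf ▸ G.src_lt_tgt f)
  have hI : Ioo (D.pos v) (min (D.pos (G.tgt e)) (D.pos (G.tgt f))) ∈ 𝓝[>] (D.pos v) :=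
    Ioo_mem_nhdsGT (lt_min h1 h2)
  have ce := D.continuousOn_curve e
  have cf := D.continuousOn_curve f
  have hn := D.curve_ne_curve f e hne.symm
  rw [he] at ce hn
  rw [hf] at cf hn
  rcases lt_or_lt_of_ne (a := D.pos v) (b := min (D.pos (G.tgt e)) (D.pos (G.tgt f)))
      (cf.mono fun x hx => ⟨hx.1.le, (hx.2.trans_le (min_le_right _ _)).le⟩)
      (ce.mono fun x hx => ⟨hx.1.le, (hx.2.trans_le (min_le_left _ _)).le⟩)
      (fun x hx => hn x ⟨hx.1, hx.2.trans_le (min_le_right _ _)⟩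
        ⟨hx.1, hx.2.trans_le (min_le_left _ _)⟩) with h | h
  · exact Or.inl (mem_of_superset hI h)
  · exact Or.inr (mem_of_superset hI h)

/-- The planar framing: the incoming and the outgoing edges of each vertex are ordered from top to
bottom. -/
def planarFraming : G.Framing where
  inLT := D.AboveIn
  outLT := D.AboveOut
  in_linear v _ :=
    { trichotomous := fun e f h1 h2 => by
        by_contra hne
        rcases D.aboveIn_total e.2 f.2 (fun h => hne (Subtype.ext h)) with h | h
        · exact h1 h
        · exact h2 h
      irrefl := fun e h => (h.exists).elim fun x hx => lt_irrefl _ hx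
      trans := fun e f g h1 h2 => by
        filter_upwards [h1, h2] with x hx1 hx2 using hx2.trans hx1 }
  out_linear v _ :=
    { trichotomous := fun e f h1 h2 => by
        by_contra hne
        rcases D.aboveOut_total e.2 f.2 (fun h => hne (Subtype.ext h)) with h | h
        · exact h1 h
        · exact h2 h
      irrefl := fun e h => (h.exists).elim fun x hx => lt_irrefl _ hx
      trans := fun e f g h1 h2 => by
        filter_upwards [h1, h2] with x hx1 hx2 using hx2.trans hx1 }

end FlowGraph.PlanarDrawing

/-! Extended by zero, a route is the graph of a continuous function, its height. It separates the
bounded regions into those above it and those not above it. Crossing an edge upwards changes the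
side with respect to a route exactly when the edge lies on the route, and then the change is from
below to above. Hence the regions above a route `p` form an up-set `regionsAbove p`. An upward dual
path that starts in the unbounded region below crosses `p` once if it ends above `p`, and never
otherwise. So `Φ` sends the vertex of `p` to the indicator of `regionsAbove p`
(`flowToOrder_routeFlow`). Conversely, the edges with an up-set directly above but not directly
below them contain a route, and this route has exactly that up-set above it
(`exists_regionsAbove_eq`).

The flow polytope is the convex hull of the route vertices, by decomposition of flows, and the order
polytope is the convex hull of the indicators of up-sets. Therefore `Φ` maps one onto the other. It
is injective on flows because the flow through an edge is the value above it minus the value below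
it, where the unbounded region counts as 1 above the drawing and as 0 below it.

For the triangulations, two routes are coherent for the planar framing if and only if they do not
cross, that is, one is weakly above the other (`coherent_iff`), and this means that their up-sets
are nested (`regionsAbove_subset_iff`). Thus cliques of routes become chains of up-sets. The
simplices of the canonical triangulation are the hulls of the indicators of nonempty chains of
up-sets, and the top dimensional ones belong to the maximal chains, because every chain of up-sets
is compatible with some linear extension.

Since the edges are graphs of functions, the topology reduces to vertical lines and intermediate
values; no Jordan curve theorem is needed. -/

/-! ### Chains of up-sets and the canonical triangulation -/

/-- A linear order on a finite type is given by an enumeration. -/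
theorem exists_enum_of_isLinearOrder {P : Type*} [Finite P] (s : P → P → Prop)
    [hs : IsLinearOrder P s] :
    ∃ e : Fin (Nat.card P) ≃ P, ∀ i j, s (e i) (e j) ↔ i ≤ j := by
  classical
  let := Fintype.ofFinite P
  let : LinearOrder P :=
    { le := s
      le_refl := hs.refl
      le_trans := hs.trans
      le_antisymm := hs.antisymm
      le_total := hs.total
      toDecidableLE := Classical.decRel _ }
  have e := Fintype.orderIsoFinOfCardEq P (Nat.card_eq_fintype_card (α := P)).symm
  exact ⟨e.toEquiv, fun i j => e.le_iff_le⟩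

/-! ### Vertices of the simplex of a linear extension -/

namespace PosetLinearExtension

variable {P : Type*} [Preorder P] (a : PosetLinearExtension P)

/-- The sets that are up-closed for the order of a linear extension. -/
def upperSets : Set (Set P) := {F | ∀ i j, i ≤ j → a.enum i ∈ F → a.enum j ∈ F}

theorem isUpperSet_of_mem {F : Set P} (hF : F ∈ a.upperSets) : IsUpperSet F := by
  intro x y hxy hx
  have := hF (a.enum.symm x) (a.enum.symm y) (a.le_of_le _ _ (by simpa using hxy))
  simpa using this (by simpa using hx)

theorem isChain_upperSets : IsChain (· ⊆ ·) a.upperSets := by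
  intro F hF G hG _
  by_contra! h
  obtain ⟨⟨x, hx, hx'⟩, y, hy, hy'⟩ := And.imp not_subset.1 not_subset.1 h
  rcases le_total (a.enum.symm x) (a.enum.symm y) with h | h
  · exact hy' (by simpa using hF _ _ h (by simpa using hx))
  · exact hx' (by simpa using hG _ _ h (by simpa using hy))

theorem indicator_mem_simplex {F : Set P} (hF : F ∈ a.upperSets) :
    F.indicator (1 : P → ℝ) ∈ a.simplex := by
  classical
  refine ⟨fun t => ?_, fun i j hij => ?_⟩
  · by_cases h : t ∈ F <;> simp [h]
  · by_cases h : a.enum i ∈ F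
    · simp [h, hF i j hij h]
    · by_cases h' : a.enum j ∈ F <;> simp [h, h']

theorem convex_simplex : Convex ℝ a.simplex := by
  rintro x ⟨hx1, hx2⟩ y ⟨hy1, hy2⟩ s t hs ht hst
  refine ⟨fun b => ⟨?_, ?_⟩, fun i j hij => ?_⟩
  · have := (hx1 b).1
    have := (hy1 b).1
    simp only [Pi.add_apply, Pi.smul_apply, smul_eq_mul]
    positivity
  · have := mul_le_mul_of_nonneg_left (hx1 b).2 hs
    have := mul_le_mul_of_nonneg_left (hy1 b).2 ht
    simp only [Pi.add_apply, Pi.smul_apply, smul_eq_mul]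
    linarith
  · have := mul_le_mul_of_nonneg_left (hx2 i j hij) hs
    have := mul_le_mul_of_nonneg_left (hy2 i j hij) ht
    simp only [Pi.add_apply, Pi.smul_apply, smul_eq_mul]
    linarith

/-- Abel summation: the increments of the monotone sequence of coordinates are the barycentric
coordinates with respect to the indicators of the final segments. -/
theorem simplex_eq_convexHull :
    a.simplex = convexHull ℝ ((fun F => F.indicator (1 : P → ℝ)) '' a.upperSets) := by
  classical
  apply Subset.antisymm
  · rintro x ⟨hx1, hx2⟩
    set N := Nat.card P
    -- The coordinates in the order of the extension, shifted by one and padded with 0 in front and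
    -- 1 at the end. The `N + 1` increments are nonnegative and telescope to 1; the last one is the
    -- weight of the empty set.
    let z : ℕ → ℝ := fun k => if k = 0 then 0 else
      if h : k - 1 < N then x (a.enum ⟨k - 1, h⟩) else 1
    have hz0 : z 0 = 0 := by simp [z]
    have hzs : ∀ k (h : k < N), z (k + 1) = x (a.enum ⟨k, h⟩) := fun k h => by simp [z, h]
    have hzN : z (N + 1) = 1 := by simp [z]
    have hmono : ∀ k ≤ N, z k ≤ z (k + 1) := by
      intro k hk
      rcases k with _ | k
      · rw [hz0]
        by_cases h : 0 < N
        · rw [hzs 0 h]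
          exact (hx1 _).1
        · have : N = 0 := by omega
          rw [← this, hzN]
          exact zero_le_one
      · rw [hzs k hk]
        by_cases h : k + 1 < N
        · rw [hzs _ h]
          exact hx2 _ _ (by simp [Fin.le_def])
        · have : k + 1 = N := by omega
          rw [this, hzN]
          exact (hx1 _).2
    have hsum : ∑ k ∈ Finset.range (N + 1), (z (k + 1) - z k) = 1 := by
      rw [Finset.sum_range_sub, hz0, hzN, sub_zero]
    let F : ℕ → Set P := fun k => {p | k ≤ a.enum.symm p}
    have hF : ∀ k, F k ∈ a.upperSets := by
      intro k i j hij hi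
      simp only [F, mem_ofPred_eq, Equiv.symm_apply_apply] at hi ⊢
      exact hi.trans hij
    have hx : x = ∑ k ∈ Finset.range (N + 1), (z (k + 1) - z k) • (F k).indicator (1 : P → ℝ) := by
      funext p
      obtain ⟨⟨j, hj⟩, rfl⟩ := a.enum.surjective p
      simp only [Finset.sum_apply, Pi.smul_apply, smul_eq_mul]
      have : ∀ k ∈ Finset.range (N + 1), (z (k + 1) - z k) *
          (F k).indicator (1 : P → ℝ) (a.enum ⟨j, hj⟩) = if k < j + 1 then z (k + 1) - z k else 0 := by
        intro k _
        by_cases h : k ≤ j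
        · have h' : a.enum ⟨j, hj⟩ ∈ F k := by simpa [F] using h
          rw [indicator_of_mem h', if_pos (by omega)]
          simp
        · have h' : a.enum ⟨j, hj⟩ ∉ F k := by simpa [F] using h
          rw [indicator_of_notMem h', if_neg (by omega)]
          simp
      rw [Finset.sum_congr rfl this, ← Finset.sum_filter]
      have hfil : (Finset.range (N + 1)).filter (· < j + 1) = Finset.range (j + 1) := by
        ext k
        simp only [Finset.mem_filter, Finset.mem_range]
        omega
      rw [hfil, Finset.sum_range_sub, hz0, hzs j hj, sub_zero]
    rw [hx]
    refine (convex_convexHull ℝ _).sum_mem (fun k hk => ?_) hsum fun k _ =>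
      subset_convexHull ℝ _ ⟨F k, hF k, rfl⟩
    exact sub_nonneg.2 (hmono k (by simpa [Nat.lt_succ_iff] using hk))
  · refine convexHull_min ?_ a.convex_simplex
    rintro _ ⟨F, hF, rfl⟩
    exact a.indicator_mem_simplex hF

/-- An indicator takes only the values 0 and 1, which are extreme in the range of every coordinate,
so a proper convex combination reaches it only if both of its points do. -/
theorem extremePoints_simplex :
    a.simplex.extremePoints ℝ = (fun F => F.indicator (1 : P → ℝ)) '' a.upperSets := by
  apply Subset.antisymm
  · rw [simplex_eq_convexHull]
    exact extremePoints_convexHull_subset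
  · rintro _ ⟨F, hF, rfl⟩
    refine mem_extremePoints.2 ⟨a.indicator_mem_simplex hF, ?_⟩
    have key : ∀ x ∈ a.simplex, ∀ y ∈ a.simplex, F.indicator (1 : P → ℝ) ∈ openSegment ℝ x y →
        x = F.indicator 1 := by
      rintro x hx y hy ⟨s, t, hs, ht, hst, h⟩
      funext p
      have hp := congrFun h p
      simp only [Pi.add_apply, Pi.smul_apply, smul_eq_mul] at hp
      by_cases hpF : p ∈ F
      · rw [indicator_of_mem hpF] at hp ⊢
        simp only [Pi.one_apply] at hp ⊢
        have h1 := (hx.1 p).2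
        have h2 := (hy.1 p).2
        by_contra hne
        have := mul_lt_mul_of_pos_left (lt_of_le_of_ne h1 hne) hs
        have := mul_le_mul_of_nonneg_left h2 ht.le
        linarith
      · rw [indicator_of_notMem hpF] at hp ⊢
        have h1 := (hx.1 p).1
        have h2 := mul_nonneg ht.le (hy.1 p).1
        by_contra hne
        have := mul_pos hs (lt_of_le_of_ne h1 (Ne.symm hne))
        linarith
    intro x hx y hy h
    exact ⟨key x hx y hy h, key y hy x hx (by rwa [openSegment_symm])⟩

/-- The chain of final segments is saturated: a set that contains the element at `i` and is
comparable with the segment strictly after `i` must contain that segment. -/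
theorem eq_upperSets_of_isChain {C : Set (Set P)} (hC : IsChain (· ⊆ ·) C)
    (h : a.upperSets ⊆ C) : C = a.upperSets := by
  refine Subset.antisymm (fun F hF i j hij hi => ?_) h
  rcases hij.eq_or_lt with rfl | hij
  · exact hi
  have hG : {p | i < a.enum.symm p} ∈ a.upperSets := by
    intro k l hkl hk
    simp only [mem_ofPred_eq, Equiv.symm_apply_apply] at hk ⊢
    exact hk.trans_le hkl
  rcases hC.total hF (h hG) with h' | h'
  · simpa using h' hi
  · exact h' (by simpa using hij)

end PosetLinearExtension

/-! ### Chains of up-sets and compatible linear extensions -/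

section Chains

variable {P : Type*} [Preorder P]

/-- Chains of up-sets. -/
def IsUpperChain (C : Set (Set P)) : Prop := (∀ F ∈ C, IsUpperSet F) ∧ IsChain (· ⊆ ·) C

theorem PosetLinearExtension.isUpperChain_upperSets (a : PosetLinearExtension P) :
    IsUpperChain a.upperSets :=
  ⟨fun _ => a.isUpperSet_of_mem, a.isChain_upperSets⟩

/-- Each chain of up-sets is compatible with some linear extension. -/
theorem IsUpperChain.exists_subset_upperSets [Finite P]
    (hP : ∀ x y : P, x ≤ y → y ≤ x → x = y) {C : Set (Set P)} (hC : IsUpperChain C) :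
    ∃ a : PosetLinearExtension P, C ⊆ a.upperSets := by
  -- Lexicographic comparison: first by membership in the sets of the chain, and by the order of `P`
  -- between points that the chain does not separate. It extends the order of `P` because the
  -- members of the chain are up-sets.
  let r : P → P → Prop := fun x y =>
    (∀ F ∈ C, x ∈ F → y ∈ F) ∧ ((∀ F ∈ C, y ∈ F → x ∈ F) → x ≤ y)
  have : IsPartialOrder P r :=
    { refl := fun x => ⟨fun _ _ h => h, fun _ => le_refl x⟩
      trans := fun x y z h1 h2 => ⟨fun F hF h => h2.1 F hF (h1.1 F hF h), fun h =>
        (h1.2 fun F hF hy => h F hF (h2.1 F hF hy)).trans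
          (h2.2 fun F hF hz => h1.1 F hF (h F hF hz))⟩
      antisymm := fun x y h1 h2 => hP x y (h1.2 h2.1) (h2.2 h1.1) }
  obtain ⟨s, hs, hrs⟩ := extend_partialOrder r
  obtain ⟨e, he⟩ := exists_enum_of_isLinearOrder s
  refine ⟨⟨e, fun i j hij => (he i j).1 (hrs _ _ ⟨fun F hF h => hC.1 F hF hij h, fun _ => hij⟩)⟩,
    fun F hF i j hij hi => ?_⟩
  change e i ∈ F at hi
  change e j ∈ F
  by_contra hj
  -- The set `F` separates the two points. Any `G` in the chain that contains `e j` is not inside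
  -- `F`, so it contains `F` and with it `e i`; the tie clause is void.
  have hr : r (e j) (e i) := by
    refine ⟨fun G hG h => ?_, fun h => absurd (h F hF hi) hj⟩
    rcases hC.2.total hF hG with h' | h'
    · exact h' hi
    · exact absurd (h' h) hj
  have := hs.antisymm _ _ ((he i j).2 hij) (hrs _ _ hr)
  exact hj (this ▸ hi)

/-- The superlevel sets of an order-preserving function are a chain of up-sets, and along a
compatible linear extension the function is nondecreasing. -/
theorem exists_mem_simplex [Finite P] (hP : ∀ x y : P, x ≤ y → y ≤ x → x = y) {x : P → ℝ}
    (hx : x ∈ orderPolytope P) : ∃ a : PosetLinearExtension P, x ∈ a.simplex := by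
  have hC : IsUpperChain (range fun t : ℝ => {p | t ≤ x p}) := by
    constructor
    · rintro _ ⟨t, rfl⟩ p q hpq hp
      exact le_trans hp (hx.2 p q hpq)
    · rintro _ ⟨t, rfl⟩ _ ⟨u, rfl⟩ _
      rcases le_total t u with h | h
      · exact Or.inr fun p hp => h.trans hp
      · exact Or.inl fun p hp => h.trans hp
  obtain ⟨a, ha⟩ := hC.exists_subset_upperSets hP
  refine ⟨a, hx.1, fun i j hij => ?_⟩
  have := ha ⟨x (a.enum i), rfl⟩ i j hij
  simpa using this

theorem orderPolytope_eq_convexHull [Finite P] (hP : ∀ x y : P, x ≤ y → y ≤ x → x = y) :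
    orderPolytope P =
      convexHull ℝ ((fun F => F.indicator (1 : P → ℝ)) '' {F | IsUpperSet F}) := by
  apply Subset.antisymm
  · intro x hx
    obtain ⟨a, ha⟩ := exists_mem_simplex hP hx
    rw [a.simplex_eq_convexHull] at ha
    exact convexHull_mono (image_mono fun F => a.isUpperSet_of_mem) ha
  · refine convexHull_min ?_ ?_
    · rintro _ ⟨F, hF, rfl⟩
      refine ⟨fun t => ?_, fun p q hpq => ?_⟩
      · by_cases h : t ∈ F <;> simp [h]
      · by_cases h : p ∈ F
        · simp [h, hF hpq h]
        · by_cases h' : q ∈ F <;> simp [h, h']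
    · rintro x ⟨hx1, hx2⟩ y ⟨hy1, hy2⟩ s t hs ht hst
      refine ⟨fun b => ⟨?_, ?_⟩, fun i j hij => ?_⟩
      · have := (hx1 b).1
        have := (hy1 b).1
        simp only [Pi.add_apply, Pi.smul_apply, smul_eq_mul]
        positivity
      · have := mul_le_mul_of_nonneg_left (hx1 b).2 hs
        have := mul_le_mul_of_nonneg_left (hy1 b).2 ht
        simp only [Pi.add_apply, Pi.smul_apply, smul_eq_mul]
        linarith
      · have := mul_le_mul_of_nonneg_left (hx2 i j hij) hs
        have := mul_le_mul_of_nonneg_left (hy2 i j hij) ht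
        simp only [Pi.add_apply, Pi.smul_apply, smul_eq_mul]
        linarith

/-- The simplices of the canonical triangulation belong to the nonempty chains of up-sets. -/
theorem canonicalTriangulation_eq [Finite P] (hP : ∀ x y : P, x ≤ y → y ≤ x → x = y) :
    canonicalTriangulation P = {s | ∃ C : Set (Set P), IsUpperChain C ∧ C.Nonempty ∧
      s = convexHull ℝ ((fun F => F.indicator (1 : P → ℝ)) '' C)} := by
  ext s
  constructor
  · rintro ⟨a, V, hV, hne, rfl⟩
    rw [a.extremePoints_simplex] at hV
    obtain ⟨C, hC, rfl⟩ := subset_image_iff.1 hV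
    exact ⟨C, ⟨fun F hF => a.isUpperSet_of_mem (hC hF), a.isChain_upperSets.mono hC⟩,
      hne.of_image, rfl⟩
  · rintro ⟨C, hC, hne, rfl⟩
    obtain ⟨a, ha⟩ := hC.exists_subset_upperSets hP
    refine ⟨a, _, ?_, hne.image _, rfl⟩
    rw [a.extremePoints_simplex]
    exact image_mono ha

/-- The top dimensional simplices of the canonical triangulation belong to the maximal chains of
up-sets. -/
theorem canonicalTopSimplices_eq [Finite P] (hP : ∀ x y : P, x ≤ y → y ≤ x → x = y) :
    canonicalTopSimplices P = {s | ∃ C : Set (Set P), Maximal IsUpperChain C ∧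
      s = convexHull ℝ ((fun F => F.indicator (1 : P → ℝ)) '' C)} := by
  ext s
  constructor
  · rintro ⟨a, rfl⟩
    exact ⟨a.upperSets, ⟨a.isUpperChain_upperSets, fun C hC h =>
      (a.eq_upperSets_of_isChain hC.2 h).le⟩, a.simplex_eq_convexHull⟩
  · rintro ⟨C, hC, rfl⟩
    obtain ⟨a, ha⟩ := hC.1.exists_subset_upperSets hP
    exact ⟨a, by rw [a.simplex_eq_convexHull, hC.eq_of_le a.isUpperChain_upperSets ha]⟩

end Chains

/-! ### Paths and the vertices of the flow polytope -/

namespace FlowGraph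

variable {n : ℕ} {E : Type*} {G : FlowGraph n E}

theorem isPath_append {u v : Fin (n + 2)} {p q : List E} :
    G.IsPath u v (p ++ q) ↔ ∃ w, G.IsPath u w p ∧ G.IsPath w v q := by
  induction p generalizing u with
  | nil => simp [IsPath]
  | cons e p ih => simp [IsPath, ih, and_assoc]

theorem IsPath.le {u v : Fin (n + 2)} {p : List E} (h : G.IsPath u v p) : u ≤ v := by
  induction p generalizing u with
  | nil => exact le_of_eq h
  | cons e p ih => exact h.1 ▸ (G.src_lt_tgt e).le.trans (ih h.2)

theorem IsPath.le_src {u v : Fin (n + 2)} {p : List E} (h : G.IsPath u v p) {e : E} (he : e ∈ p) :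
    u ≤ G.src e := by
  obtain ⟨p', q', rfl⟩ := List.append_of_mem he
  obtain ⟨w, h1, h2⟩ := isPath_append.1 h
  exact h2.1 ▸ h1.le

theorem IsPath.tgt_le {u v : Fin (n + 2)} {p : List E} (h : G.IsPath u v p) {e : E} (he : e ∈ p) :
    G.tgt e ≤ v := by
  obtain ⟨p', q', rfl⟩ := List.append_of_mem he
  obtain ⟨w, h1, h2⟩ := isPath_append.1 h
  exact h2.2.le

theorem IsPath.eq_nil {u : Fin (n + 2)} {p : List E} (h : G.IsPath u u p) : p = [] := by
  rcases p with _ | ⟨e, p⟩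
  · rfl
  · exact absurd (h.1 ▸ G.src_lt_tgt e) (h.2.le.not_gt)

theorem IsPath.target_unique {u v w : Fin (n + 2)} {p : List E} (h : G.IsPath u v p)
    (h' : G.IsPath u w p) : v = w := by
  induction p generalizing u with
  | nil => exact h.symm.trans h'
  | cons e p ih => exact ih h.2 h'.2

theorem IsPath.source_unique {u v w : Fin (n + 2)} {p : List E} (h : G.IsPath u v p)
    (h' : G.IsPath w v p) (hp : p ≠ []) : u = w := by
  rcases p with _ | ⟨e, p⟩
  · exact absurd rfl hp
  · exact h.1.symm.trans h'.1

theorem IsPath.notMem_tail {u v : Fin (n + 2)} {e : E} {p : List E} (h : G.IsPath u v (e :: p)) :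
    e ∉ p := fun he => (h.2.le_src he).not_gt (G.src_lt_tgt e)

/-- Edges lead to larger vertices, so prolonging a path within `B` can stop only at the sink. This
serves for the set of all edges, the support of a flow and the lower boundary of an up-set. -/
theorem exists_path_to_last {B : Set E}
    (hB : ∀ e ∈ B, G.tgt e ≠ Fin.last (n + 1) → ∃ f ∈ B, G.src f = G.tgt e) {e : E} (he : e ∈ B) :
    ∃ p, G.IsPath (G.tgt e) (Fin.last (n + 1)) p ∧ ∀ f ∈ p, f ∈ B := by
  induction hv : G.tgt e using WellFoundedGT.induction generalizing e with
  | ind v ih =>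
    by_cases h : v = Fin.last (n + 1)
    · exact ⟨[], h, by simp⟩
    · obtain ⟨f, hf, hfe⟩ := hB e he (hv ▸ h)
      obtain ⟨p, hp, hpB⟩ := ih (G.tgt f) (by rw [← hv, ← hfe]; exact G.src_lt_tgt f) hf rfl
      exact ⟨f :: p, ⟨hfe.trans hv, hp⟩, by simpa using ⟨hf, hpB⟩⟩

theorem exists_path_from_zero {B : Set E}
    (hB : ∀ e ∈ B, G.src e ≠ 0 → ∃ f ∈ B, G.tgt f = G.src e) {e : E} (he : e ∈ B) :
    ∃ p, G.IsPath 0 (G.src e) p ∧ ∀ f ∈ p, f ∈ B := by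
  induction hv : G.src e using WellFoundedLT.induction generalizing e with
  | ind v ih =>
    by_cases h : v = 0
    · exact ⟨[], h.symm, by simp⟩
    · obtain ⟨f, hf, hfe⟩ := hB e he (hv ▸ h)
      obtain ⟨p, hp, hpB⟩ := ih (G.src f) (by rw [← hv, ← hfe]; exact G.src_lt_tgt f) hf rfl
      refine ⟨p ++ [f], isPath_append.2 ⟨_, hp, rfl, hfe.trans hv⟩, fun g hg => ?_⟩
      rcases List.mem_append.1 hg with h | h
      · exact hpB g h
      · exact List.mem_singleton.1 h ▸ hf

theorem exists_route_mem {B : Set E}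
    (hB : ∀ e ∈ B, G.tgt e ≠ Fin.last (n + 1) → ∃ f ∈ B, G.src f = G.tgt e)
    (hB' : ∀ e ∈ B, G.src e ≠ 0 → ∃ f ∈ B, G.tgt f = G.src e) {e : E} (he : e ∈ B) :
    ∃ p, G.IsRoute p ∧ e ∈ p ∧ ∀ f ∈ p, f ∈ B := by
  obtain ⟨p, hp, hpB⟩ := exists_path_from_zero hB' he
  obtain ⟨q, hq, hqB⟩ := exists_path_to_last hB he
  refine ⟨p ++ e :: q, isPath_append.2 ⟨_, hp, rfl, hq⟩, by simp, fun f hf => ?_⟩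
  rcases List.mem_append.1 hf with h | h
  · exact hpB f h
  · rcases List.mem_cons.1 h with rfl | h
    exacts [he, hqB f h]

/-! ### Existence of routes through every edge -/

variable (G) in
/-- Each vertex except the sink has an outgoing edge, and each vertex except the source an
incoming one. -/
def Passable : Prop :=
  (∀ v, v ≠ Fin.last (n + 1) → ∃ e, G.src e = v) ∧ ∀ v, v ≠ 0 → ∃ e, G.tgt e = v

/-- Connectedness matters only at the two outer vertices: each is incident with some edge, which can
only leave the source or enter the sink. -/
theorem Connected.passable (hG : G.Connected)
    (hinner : ∀ v, G.IsInner v → (∃ e, G.tgt e = v) ∧ ∃ e, G.src e = v) : G.Passable := by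
  have adj : ∀ v : Fin (n + 2), ∃ e, G.src e = v ∨ G.tgt e = v := by
    intro v
    obtain ⟨w, hw⟩ := hG.preconnected.exists_adj_of_nontrivial v
    rw [SimpleGraph.fromRel_adj] at hw
    rcases hw.2 with ⟨e, h1, h2⟩ | ⟨e, h1, h2⟩
    exacts [⟨e, Or.inl h1⟩, ⟨e, Or.inr h2⟩]
  constructor
  · intro v hv
    by_cases h0 : v = 0
    · obtain ⟨e, h | h⟩ := adj v
      · exact ⟨e, h⟩
      · exact absurd (G.src_lt_tgt e) (by rw [h, h0]; exact (Fin.zero_le _).not_gt)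
    · exact (hinner v ⟨h0, hv⟩).2
  · intro v hv
    by_cases h0 : v = Fin.last (n + 1)
    · obtain ⟨e, h | h⟩ := adj v
      · exact absurd (G.src_lt_tgt e) (by rw [h, h0]; exact (Fin.le_last _).not_gt)
      · exact ⟨e, h⟩
    · exact (hinner v ⟨hv, h0⟩).1

theorem Passable.exists_route (h : G.Passable) (e : E) : ∃ p, G.IsRoute p ∧ e ∈ p := by
  obtain ⟨p, hp, he, -⟩ := exists_route_mem (B := univ) (G := G)
    (fun e _ he => by simpa using h.1 _ he) (fun e _ he => by simpa using h.2 _ he) (mem_univ e)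
  exact ⟨p, hp, he⟩

theorem Passable.exists_edge (h : G.Passable) : Nonempty E :=
  (h.1 0 (Fin.last_pos).ne).nonempty

/-! ### Unit flows and the decomposition of flows into routes -/

theorem routeFlow_cons {u v : Fin (n + 2)} {e : E} {p : List E} (h : G.IsPath u v (e :: p)) (f : E)
    [Decidable (f = e)] :
    G.routeFlow (e :: p) f = (if f = e then 1 else 0) + G.routeFlow p f := by
  classical
  have := h.notMem_tail
  unfold routeFlow
  by_cases hf : f = e
  · subst hf
    simp [this]
  · by_cases hp : f ∈ p <;> simp [hf, hp]

/-- Conservation with a unit entering at the start and a unit leaving at the end. With these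
boundary terms the identity holds at all vertices and passes through the induction along the path.
-/
theorem IsPath.sum_routeFlow [Fintype E] {u v : Fin (n + 2)} {p : List E} (h : G.IsPath u v p)
    (w : Fin (n + 2)) :
    ∑ e with G.tgt e = w, G.routeFlow p e + (if w = u then 1 else 0) =
      ∑ e with G.src e = w, G.routeFlow p e + (if w = v then 1 else 0) := by
  classical
  induction p generalizing u with
  | nil => cases h; simp [routeFlow]
  | cons e p ih =>
    have := ih h.2
    simp only [routeFlow_cons h, Finset.sum_add_distrib, Finset.sum_ite_eq', Finset.mem_filter,
      Finset.mem_univ, true_and]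
    rw [h.1]
    simp only [eq_comm (a := w)] at this ⊢
    linarith

theorem routeFlow_mem_flowPolytope [Fintype E] {p : List E} (hp : G.IsRoute p) :
    G.routeFlow p ∈ G.flowPolytope := by
  classical
  have hs := IsPath.sum_routeFlow hp
  have h0 : ∑ e with G.tgt e = 0, G.routeFlow p e = 0 := by
    rw [Finset.filter_false_of_mem, Finset.sum_empty]
    intro e _ he
    exact absurd (G.src_lt_tgt e) (by rw [he]; exact (Fin.zero_le _).not_gt)
  have hl : ∑ e with G.src e = Fin.last (n + 1), G.routeFlow p e = 0 := by
    rw [Finset.filter_false_of_mem, Finset.sum_empty]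
    intro e _ he
    exact absurd (G.src_lt_tgt e) (by rw [he]; exact (Fin.le_last _).not_gt)
  refine ⟨fun e => indicator_nonneg (fun _ _ => zero_le_one) _, ?_, ?_, fun v hv => ?_⟩
  · have := hs 0
    rw [h0] at this
    simpa [Fin.last_pos.ne] using this.symm
  · have := hs (Fin.last (n + 1))
    rw [hl] at this
    simpa [Fin.last_pos.ne'] using this
  · simpa [hv.1, hv.2] using hs v

theorem convex_flowPolytope [Fintype E] : Convex ℝ G.flowPolytope := by
  rintro x ⟨hx1, hx2, hx3, hx4⟩ y ⟨hy1, hy2, hy3, hy4⟩ s t hs ht hst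
  have key : ∀ T : Finset E, ∑ e ∈ T, (s • x + t • y) e = s * ∑ e ∈ T, x e + t * ∑ e ∈ T, y e := by
    intro T
    simp [Finset.sum_add_distrib, Finset.mul_sum]
  refine ⟨fun e => ?_, ?_, ?_, fun v hv => ?_⟩
  · have := hx1 e
    have := hy1 e
    simp only [Pi.add_apply, Pi.smul_apply, smul_eq_mul]
    positivity
  · rw [key, hx2, hy2]
    linarith
  · rw [key, hx3, hy3]
    linarith
  · rw [key, key, hx4 v hv, hy4 v hv]

/-- Each positive edge of a flow lies on a route with positive flow. -/
theorem exists_positive_route [Fintype E] {fl : E → ℝ} (h0 : ∀ e, 0 ≤ fl e)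
    (hfl : ∀ v, G.IsInner v → ∑ e with G.tgt e = v, fl e = ∑ e with G.src e = v, fl e) {e : E}
    (he : 0 < fl e) : ∃ p, G.IsRoute p ∧ e ∈ p ∧ ∀ f ∈ p, 0 < fl f := by
  refine exists_route_mem (B := {e | 0 < fl e}) (fun e he hl => ?_) (fun e he hl => ?_) he
  · have hin : G.IsInner (G.tgt e) := ⟨((Fin.zero_le _).trans_lt (G.src_lt_tgt e)).ne', hl⟩
    have h1 : 0 < ∑ f with G.tgt f = G.tgt e, fl f :=
      Finset.sum_pos' (fun f _ => h0 f) ⟨e, by simp, he⟩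
    rw [hfl _ hin] at h1
    obtain ⟨f, hf, hf'⟩ := Finset.exists_ne_zero_of_sum_ne_zero h1.ne'
    exact ⟨f, lt_of_le_of_ne (h0 f) hf'.symm, by simpa using hf⟩
  · have hin : G.IsInner (G.src e) := ⟨hl, ((G.src_lt_tgt e).trans_le (Fin.le_last _)).ne⟩
    have h1 : 0 < ∑ f with G.src f = G.src e, fl f :=
      Finset.sum_pos' (fun f _ => h0 f) ⟨e, by simp, he⟩
    rw [← hfl _ hin] at h1
    obtain ⟨f, hf, hf'⟩ := Finset.exists_ne_zero_of_sum_ne_zero h1.ne'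
    exact ⟨f, lt_of_le_of_ne (h0 f) hf'.symm, by simpa using hf⟩

/-- Flows are nonnegative combinations of routes. -/
theorem mem_hull_of_flow [Fintype E] {fl : E → ℝ} (h0 : ∀ e, 0 ≤ fl e)
    (hfl : ∀ v, G.IsInner v → ∑ e with G.tgt e = v, fl e = ∑ e with G.src e = v, fl e)
    (hne : fl ≠ 0) :
    fl ∈ ConvexCone.hull ℝ (convexHull ℝ (G.routeFlow '' {p | G.IsRoute p})) := by
  classical
  induction hk : (Finset.univ.filter fun e => fl e ≠ 0).card using Nat.strong_induction_on
    generalizing fl with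
  | _ k ih =>
    obtain ⟨e, he⟩ := Function.ne_iff.1 hne
    obtain ⟨p, hp, hep, hpos⟩ := exists_positive_route h0 hfl (lt_of_le_of_ne (h0 e) (Ne.symm he))
    -- A bottleneck edge `f` of the route: subtracting `fl f` times the unit flow keeps the flow
    -- nonnegative and empties `f`, so the support shrinks.
    obtain ⟨f, hf, hmin⟩ := Finset.exists_min_image p.toFinset fl ⟨e, by simpa using hep⟩
    simp only [List.mem_toFinset] at hf hmin
    set K := ConvexCone.hull ℝ (convexHull ℝ (G.routeFlow '' {p | G.IsRoute p}))
    have hpK : fl f • G.routeFlow p ∈ K :=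
      K.smul_mem (hpos f hf) (ConvexCone.subset_hull (subset_convexHull ℝ _ ⟨p, hp, rfl⟩))
    have hsum : fl = fl f • G.routeFlow p + (fl - fl f • G.routeFlow p) := by abel
    by_cases hz : fl - fl f • G.routeFlow p = 0
    · rwa [hsum, hz, add_zero]
    · rw [hsum]
      have hval : ∀ g, (fl - fl f • G.routeFlow p) g = if g ∈ p then fl g - fl f else fl g := by
        intro g
        by_cases hg : g ∈ p <;> simp [routeFlow, hg]
      refine K.add_mem hpK (ih _ ?_ ?_ ?_ hz rfl)
      · rw [← hk]
        apply Finset.card_lt_card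
        refine Finset.ssubset_iff_of_subset (fun g hg => ?_) |>.2 ⟨f, ?_, ?_⟩
        · simp only [Finset.mem_filter, Finset.mem_univ, true_and, hval] at hg ⊢
          split_ifs at hg with h
          · exact (hpos g h).ne'
          · exact hg
        · simpa using (hpos f hf).ne'
        · rw [Finset.mem_filter, hval, if_pos hf, sub_self]
          simp
      · intro g
        rw [hval]
        split_ifs with h
        · exact sub_nonneg.2 (hmin g h)
        · exact h0 g
      · intro v hv
        have := (routeFlow_mem_flowPolytope hp).2.2.2 v hv
        simp only [Pi.sub_apply, Pi.smul_apply, smul_eq_mul, Finset.sum_sub_distrib,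
          ← Finset.mul_sum, hfl v hv, this]

/-- The decomposition places a flow in the cone over the hull of the routes; comparing the outflow
at the source shows that the scaling factor is 1. -/
theorem flowPolytope_eq_convexHull [Fintype E] :
    G.flowPolytope = convexHull ℝ (G.routeFlow '' {p | G.IsRoute p}) := by
  have hsub : convexHull ℝ (G.routeFlow '' {p | G.IsRoute p}) ⊆ G.flowPolytope := by
    refine convexHull_min ?_ convex_flowPolytope
    rintro _ ⟨p, hp, rfl⟩
    exact routeFlow_mem_flowPolytope hp
  refine Subset.antisymm (fun fl hfl => ?_) hsub
  have hne : fl ≠ 0 := by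
    rintro rfl
    simpa using hfl.2.1
  obtain ⟨r, hr, y, hy, rfl⟩ :=
    (ConvexCone.mem_hull_of_convex (convex_convexHull ℝ _)).1 (mem_hull_of_flow hfl.1 hfl.2.2.2 hne)
  have h1 := hfl.2.1
  have h2 := (hsub hy).2.1
  simp only [Pi.smul_apply, smul_eq_mul, ← Finset.mul_sum, h2, mul_one] at h1
  simpa [h1] using hy

end FlowGraph

/-! ### Heights of edges and routes -/

/-- The region between two continuous graphs over an interval is connected. -/
theorem isPreconnected_between {I : Set ℝ} (hI : IsPreconnected I) {f g : ℝ → ℝ}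
    (hf : Continuous f) (hg : Continuous g) (hfg : ∀ x ∈ I, f x < g x) :
    IsPreconnected {q : ℝ × ℝ | q.1 ∈ I ∧ f q.1 < q.2 ∧ q.2 < g q.1} := by
  -- Rescaling the vertical fibres affinely presents the region as a continuous image of `I × (0,
  -- 1)`.
  have h : {q : ℝ × ℝ | q.1 ∈ I ∧ f q.1 < q.2 ∧ q.2 < g q.1} =
      (fun q : ℝ × ℝ => (q.1, f q.1 + q.2 * (g q.1 - f q.1))) '' (I ×ˢ Ioo (0 : ℝ) 1) := by
    ext ⟨x, y⟩
    constructor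
    · rintro ⟨hx, h1, h2⟩
      have h3 := hfg x hx
      simp only at hx h1 h2
      refine ⟨(x, (y - f x) / (g x - f x)), ⟨hx, div_pos (by linarith) (by linarith),
        (div_lt_one (by linarith)).2 (by linarith)⟩, ?_⟩
      have : g x - f x ≠ 0 := by linarith
      simp only [Prod.mk.injEq, true_and]
      field_simp
      ring
    · rintro ⟨⟨x', t⟩, ⟨hx, ht0, ht1⟩, h⟩
      simp only [Prod.mk.injEq] at h hx ht0 ht1
      obtain ⟨rfl, rfl⟩ := h
      have h3 := hfg x' hx
      refine ⟨hx, ?_, ?_⟩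
      · have := mul_pos ht0 (sub_pos.2 h3)
        simp only
        linarith
      · have := mul_lt_mul_of_pos_right ht1 (sub_pos.2 h3)
        simp only
        linarith
  rw [h]
  exact (hI.prod isPreconnected_Ioo).image _ (by fun_prop)

namespace FlowGraph.PlanarDrawing

variable {n : ℕ} {E : Type*} {G : FlowGraph n E} (D : G.PlanarDrawing)

/-- The open interval over which an edge is drawn. -/
def span (e : E) : Set ℝ := Ioo (D.pos (G.src e)) (D.pos (G.tgt e))

/-- The function whose graph is the edge `e`, extended by zero. -/
def ext (e : E) (x : ℝ) : ℝ := D.curve e (max (D.pos (G.src e)) (min x (D.pos (G.tgt e))))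

theorem pos_src_lt (e : E) : D.pos (G.src e) < D.pos (G.tgt e) :=
  D.pos_strictMono (G.src_lt_tgt e)

theorem ext_of_mem {e : E} {x : ℝ} (hx : x ∈ Icc (D.pos (G.src e)) (D.pos (G.tgt e))) :
    D.ext e x = D.curve e x := by
  rw [ext, min_eq_left hx.2, max_eq_right hx.1]

theorem ext_of_mem_span {e : E} {x : ℝ} (hx : x ∈ D.span e) : D.ext e x = D.curve e x :=
  D.ext_of_mem ⟨hx.1.le, hx.2.le⟩

theorem ext_of_le {e : E} {x : ℝ} (hx : x ≤ D.pos (G.src e)) : D.ext e x = 0 := by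
  rw [ext, max_eq_left ((min_le_left _ _).trans hx), D.curve_src]

theorem ext_of_ge {e : E} {x : ℝ} (hx : D.pos (G.tgt e) ≤ x) : D.ext e x = 0 := by
  rw [ext, min_eq_right hx, max_eq_right (D.pos_src_lt e).le, D.curve_tgt]

theorem continuous_ext (e : E) : Continuous (D.ext e) :=
  (D.continuousOn_curve e).comp_continuous (by fun_prop) fun _ =>
    ⟨le_max_left _ _, max_le (D.pos_src_lt e).le (min_le_right _ _)⟩

/-- The function whose graph is drawn by a route, extended by zero. -/
def height (p : List E) (x : ℝ) : ℝ := (p.map fun e => D.ext e x).sum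

theorem continuous_height (p : List E) : Continuous (D.height p) := by
  induction p with
  | nil => exact continuous_const
  | cons e p ih =>
    have h : D.height (e :: p) = fun x => D.ext e x + D.height p x := by
      funext x
      simp [height]
    rw [h]
    exact (D.continuous_ext e).add ih

@[simp] theorem height_cons (e : E) (p : List E) (x : ℝ) :
    D.height (e :: p) x = D.ext e x + D.height p x := by
  simp [height]

@[simp] theorem height_append (p q : List E) (x : ℝ) :
    D.height (p ++ q) x = D.height p x + D.height q x := by
  simp [height]

theorem height_of_le {u v : Fin (n + 2)} {p : List E} (h : G.IsPath u v p) {x : ℝ}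
    (hx : x ≤ D.pos u) : D.height p x = 0 := by
  refine List.sum_eq_zero fun y hy => ?_
  obtain ⟨e, he, rfl⟩ := List.mem_map.1 hy
  exact D.ext_of_le (hx.trans (D.pos_strictMono.monotone (h.le_src he)))

theorem height_of_ge {u v : Fin (n + 2)} {p : List E} (h : G.IsPath u v p) {x : ℝ}
    (hx : D.pos v ≤ x) : D.height p x = 0 := by
  refine List.sum_eq_zero fun y hy => ?_
  obtain ⟨e, he, rfl⟩ := List.mem_map.1 hy
  exact D.ext_of_ge ((D.pos_strictMono.monotone (h.tgt_le he)).trans hx)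

/-- Over the interval of `e` the earlier edges of the path have ended and the later ones have not
begun, so theirs are zero terms. At the ends this remains true because vertices have height zero. -/
theorem height_eq_ext {u v : Fin (n + 2)} {p : List E} (h : G.IsPath u v p) {e : E} (he : e ∈ p)
    {x : ℝ} (hx : x ∈ Icc (D.pos (G.src e)) (D.pos (G.tgt e))) : D.height p x = D.ext e x := by
  obtain ⟨p', q', rfl⟩ := List.append_of_mem he
  obtain ⟨w, h1, h2⟩ := isPath_append.1 h
  rw [height_append, height_cons, D.height_of_ge h1 (h2.1 ▸ hx.1), D.height_of_le h2.2 hx.2]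
  ring

theorem exists_mem_Icc {u v : Fin (n + 2)} {p : List E} (h : G.IsPath u v p) {x : ℝ}
    (hx : x ∈ Icc (D.pos u) (D.pos v)) (huv : u ≠ v) :
    ∃ e ∈ p, x ∈ Icc (D.pos (G.src e)) (D.pos (G.tgt e)) := by
  induction p generalizing u with
  | nil => exact absurd h huv
  | cons e p ih =>
    by_cases hxe : x ≤ D.pos (G.tgt e)
    · exact ⟨e, by simp, by rw [h.1]; exact hx.1, hxe⟩
    · have hlt := not_le.1 hxe
      obtain ⟨f, hf, hxf⟩ := ih h.2 ⟨hlt.le, hx.2⟩ (by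
        rintro h'
        rw [h'] at hlt
        exact hlt.not_ge hx.2)
      exact ⟨f, List.mem_cons_of_mem _ hf, hxf⟩

/-- Positions in the horizontal range of the drawing. -/
def strip : Set ℝ := Ioo (D.pos 0) (D.pos (Fin.last (n + 1)))

theorem span_subset_strip (e : E) : D.span e ⊆ D.strip := fun _ hx =>
  ⟨(D.pos_strictMono.monotone (Fin.zero_le _)).trans_lt hx.1,
    hx.2.trans_le (D.pos_strictMono.monotone (Fin.le_last _))⟩

theorem exists_mem_Icc_of_isRoute {p : List E} (h : G.IsRoute p) {x : ℝ} (hx : x ∈ D.strip) :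
    ∃ e ∈ p, x ∈ Icc (D.pos (G.src e)) (D.pos (G.tgt e)) :=
  D.exists_mem_Icc h ⟨hx.1.le, hx.2.le⟩ Fin.last_pos.ne

theorem exists_mem_span_of_isRoute {p : List E} (h : G.IsRoute p) {x : ℝ} (hx : x ∈ D.strip)
    (hg : ∀ v, x ≠ D.pos v) : ∃ e ∈ p, x ∈ D.span e := by
  obtain ⟨e, he, hxe⟩ := D.exists_mem_Icc_of_isRoute h hx
  exact ⟨e, he, lt_of_le_of_ne hxe.1 (hg _).symm, lt_of_le_of_ne hxe.2 (hg _)⟩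

theorem height_mem_support {p : List E} (h : G.IsRoute p) {x : ℝ} (hx : x ∈ D.strip) :
    (x, D.height p x) ∈ D.support := by
  obtain ⟨e, he, hxe⟩ := D.exists_mem_Icc_of_isRoute h hx
  exact Or.inr ⟨e, hxe, by simp only [D.height_eq_ext h he hxe, D.ext_of_mem hxe]⟩

/-- A route meets the interior of an edge only if it contains the edge. -/
theorem height_eq_iff {p : List E} (h : G.IsRoute p) {e : E} {x : ℝ} (hx : x ∈ D.span e) :
    D.height p x = D.ext e x ↔ e ∈ p := by
  constructor
  · intro heq
    obtain ⟨f, hf, hxf⟩ := D.exists_mem_Icc_of_isRoute h (D.span_subset_strip e hx)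
    by_contra hep
    -- At an end of `f` the edge `e` would run through a vertex, and inside `f` two different edges
    -- would meet.
    rw [D.height_eq_ext h hf hxf, D.ext_of_mem hxf, D.ext_of_mem_span hx] at heq
    rcases hxf.1.eq_or_lt with h1 | h1
    · rw [← h1, D.curve_src] at heq
      exact D.curve_ne_vertex e _ (h1 ▸ hx) heq.symm
    rcases hxf.2.eq_or_lt with h2 | h2
    · rw [h2, D.curve_tgt] at heq
      exact D.curve_ne_vertex e _ (h2 ▸ hx) heq.symm
    exact D.curve_ne_curve f e (by rintro rfl; exact hep hf) x ⟨h1, h2⟩ hx heq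
  · intro he
    exact D.height_eq_ext h he ⟨hx.1.le, hx.2.le⟩

/-! ### Cells -/

/-- The part of the strip that is not covered by the drawing. -/
def free : Set (ℝ × ℝ) := {q | q.1 ∈ D.strip ∧ q ∉ D.support}

/-- Two points are in the same cell if they are connected outside of the drawing within the open
vertical strip between the source and the sink. -/
def SameCell (q q' : ℝ × ℝ) : Prop := ∃ T ⊆ D.free, IsPreconnected T ∧ q ∈ T ∧ q' ∈ T

variable {D}

theorem SameCell.symm {q q' : ℝ × ℝ} : D.SameCell q q' → D.SameCell q' q :=
  fun ⟨T, h1, h2, h3, h4⟩ => ⟨T, h1, h2, h4, h3⟩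

theorem SameCell.trans {q q' q'' : ℝ × ℝ} : D.SameCell q q' → D.SameCell q' q'' →
    D.SameCell q q'' := fun ⟨T, h1, h2, h3, h4⟩ ⟨U, k1, k2, k3, k4⟩ =>
  ⟨T ∪ U, union_subset h1 k1, IsPreconnected.union q' h4 k3 h2 k2, Or.inl h3, Or.inr k4⟩

theorem SameCell.left_mem {q q' : ℝ × ℝ} : D.SameCell q q' → q ∈ D.free :=
  fun ⟨_, h1, _, h3, _⟩ => h1 h3

theorem SameCell.right_mem {q q' : ℝ × ℝ} (h : D.SameCell q q') : q' ∈ D.free := h.symm.left_mem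

variable (D)

theorem sameCell_vertical {x a b : ℝ} (hab : a ≤ b)
    (h : ∀ y ∈ Icc a b, (x, y) ∈ D.free) : D.SameCell (x, a) (x, b) := by
  refine ⟨{x} ×ˢ Icc a b, ?_, isPreconnected_singleton.prod isPreconnected_Icc,
    ⟨rfl, left_mem_Icc.2 hab⟩, ⟨rfl, right_mem_Icc.2 hab⟩⟩
  rintro ⟨x', y⟩ ⟨h1, h2⟩
  obtain rfl : x' = x := h1
  exact h y h2

theorem sameCell_horizontal {a b y : ℝ} (hab : a ≤ b)
    (h : ∀ x ∈ Icc a b, (x, y) ∈ D.free) : D.SameCell (a, y) (b, y) := by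
  refine ⟨Icc a b ×ˢ {y}, ?_, isPreconnected_Icc.prod isPreconnected_singleton,
    ⟨left_mem_Icc.2 hab, rfl⟩, ⟨right_mem_Icc.2 hab, rfl⟩⟩
  rintro ⟨x', y'⟩ ⟨h1, h2⟩
  obtain rfl : y' = y := h2
  exact h x' h1

theorem isClosed_graph (e : E) :
    IsClosed {q : ℝ × ℝ | q.1 ∈ Icc (D.pos (G.src e)) (D.pos (G.tgt e)) ∧ q.2 = D.ext e q.1} :=
  (isClosed_Icc.preimage continuous_fst).inter
    (isClosed_eq continuous_snd ((D.continuous_ext e).comp continuous_fst))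

theorem support_eq : D.support = (⋃ v, {(D.pos v, 0)}) ∪
    ⋃ e, {q : ℝ × ℝ | q.1 ∈ Icc (D.pos (G.src e)) (D.pos (G.tgt e)) ∧ q.2 = D.ext e q.1} := by
  ext q
  simp only [support, mem_ofPred_eq, mem_union, mem_iUnion, mem_singleton_iff]
  refine or_congr Iff.rfl (exists_congr fun e => and_congr_right fun h => ?_)
  rw [D.ext_of_mem h]

theorem isClosed_support [Finite E] : IsClosed D.support := by
  rw [support_eq]
  exact (isClosed_iUnion_of_finite fun v => isClosed_singleton).union
    (isClosed_iUnion_of_finite D.isClosed_graph)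

/-! ### The two sides of an edge -/

/-- Near an interior point of an edge, the points above the edge lie in one cell, and so do the
points below the edge. -/
theorem exists_local_cells [Finite E] (e : E) {x₀ : ℝ} (hx₀ : x₀ ∈ D.span e) :
    ∃ T ⊆ D.free, ∃ U ⊆ D.free, IsPreconnected T ∧ IsPreconnected U ∧ ∀ᶠ x in 𝓝 x₀,
      (∀ᶠ y in 𝓝[>] (D.ext e x), (x, y) ∈ T) ∧ ∀ᶠ y in 𝓝[<] (D.ext e x), (x, y) ∈ U := by
  set c := D.ext e x₀
  -- The vertices and all edges except `e`. This closed set avoids the chosen point of `e`, so in a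
  -- small box around that point the drawing consists of `e` alone.
  let K : Set (ℝ × ℝ) := (⋃ v, {(D.pos v, 0)}) ∪ ⋃ f : {f // f ≠ e},
    {q : ℝ × ℝ | q.1 ∈ Icc (D.pos (G.src f.1)) (D.pos (G.tgt f.1)) ∧ q.2 = D.ext f.1 q.1}
  have hK : IsClosed K := (isClosed_iUnion_of_finite fun v => isClosed_singleton).union
    (isClosed_iUnion_of_finite fun f => D.isClosed_graph f.1)
  have hv : ∀ v, D.pos v = x₀ → c ≠ 0 := fun v h => by
    subst h
    rw [show c = _ from D.ext_of_mem_span hx₀]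
    exact D.curve_ne_vertex e v hx₀
  have hcK : (x₀, c) ∉ K := by
    simp only [K, mem_union, mem_iUnion, mem_singleton_iff, Prod.mk.injEq, mem_ofPred_eq, not_or,
      not_exists, not_and]
    refine ⟨fun v h => hv v h.symm, fun f hf heq => ?_⟩
    rcases hf.1.eq_or_lt with h1 | h1
    · exact hv _ h1 (heq.trans (D.ext_of_le h1.ge))
    rcases hf.2.eq_or_lt with h2 | h2
    · exact hv _ h2.symm (heq.trans (D.ext_of_ge h2.ge))
    · rw [show c = _ from D.ext_of_mem_span hx₀, D.ext_of_mem_span (e := f.1) ⟨h1, h2⟩] at heq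
      exact D.curve_ne_curve e f.1 f.2.symm x₀ hx₀ ⟨h1, h2⟩ heq
  obtain ⟨r, hr, hrK⟩ := Metric.isOpen_iff.1 hK.isOpen_compl (x₀, c) hcK
  have hev : ∀ᶠ x in 𝓝 x₀, x ∈ D.span e ∧ x ∈ Metric.ball x₀ r ∧ D.ext e x ∈ Metric.ball c r :=
    (IsOpen.eventually_mem (isOpen_Ioo : IsOpen (D.span e)) hx₀).and
      ((Metric.isOpen_ball.eventually_mem (Metric.mem_ball_self hr)).and
      ((D.continuous_ext e).continuousAt.eventually (Metric.ball_mem_nhds _ hr)))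
  obtain ⟨δ, hδ, hball⟩ := Metric.eventually_nhds_iff_ball.1 hev
  have hfree : ∀ x ∈ Metric.ball x₀ δ, ∀ y ∈ Metric.ball c r, y ≠ D.ext e x → (x, y) ∈ D.free := by
    intro x hx y hy hne
    obtain ⟨h1, h2, -⟩ := hball x hx
    refine ⟨D.span_subset_strip e h1, fun hs => ?_⟩
    have hxK : (x, y) ∉ K := hrK (by rw [← ball_prod_same]; exact ⟨h2, hy⟩)
    rw [support_eq] at hs
    rcases hs with hs | hs
    · exact hxK (Or.inl hs)
    · obtain ⟨f, hf⟩ := mem_iUnion.1 hs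
      by_cases hfe : f = e
      · subst hfe
        exact hne hf.2
      · exact hxK (Or.inr (mem_iUnion.2 ⟨⟨f, hfe⟩, hf⟩))
  have hext : ∀ x ∈ Metric.ball x₀ δ, c - r < D.ext e x ∧ D.ext e x < c + r := by
    intro x hx
    have h := (hball x hx).2.2
    rw [Real.ball_eq_Ioo] at h
    exact h
  have hI : IsPreconnected (Metric.ball x₀ δ) := (convex_ball _ _).isPreconnected
  -- The two connected sets are the parts of the box above and below `e`.
  refine ⟨_, ?_, _, ?_, isPreconnected_between hI (D.continuous_ext e)
    (continuous_const (y := c + r)) fun x hx => (hext x hx).2, isPreconnected_between hI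
    (continuous_const (y := c - r)) (D.continuous_ext e) fun x hx => (hext x hx).1, ?_⟩
  · rintro ⟨x, y⟩ ⟨hx, h1, h2⟩
    have h3 := hext x hx
    simp only at h1 h2 hx
    exact hfree x hx y (by rw [Real.ball_eq_Ioo]; constructor <;> linarith) h1.ne'
  · rintro ⟨x, y⟩ ⟨hx, h1, h2⟩
    have h3 := hext x hx
    simp only at h1 h2 hx
    exact hfree x hx y (by rw [Real.ball_eq_Ioo]; constructor <;> linarith) h2.ne
  · filter_upwards [Metric.ball_mem_nhds x₀ hδ] with x hx
    constructor
    · filter_upwards [Ioo_mem_nhdsGT (hext x hx).2] with y hy using ⟨hx, hy⟩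
    · filter_upwards [Ioo_mem_nhdsLT (hext x hx).1] with y hy using ⟨hx, hy⟩

/-- If points on one side of an edge locally lie in one cell, they do so along the whole edge. -/
theorem exists_cell_along (e : E) (l : ℝ → Filter ℝ) [∀ x, (l x).NeBot]
    (hl : ∀ x₀ ∈ D.span e, ∃ T ⊆ D.free, IsPreconnected T ∧
      ∀ᶠ x in 𝓝 x₀, ∀ᶠ y in l x, (x, y) ∈ T) :
    ∃ q, ∀ x ∈ D.span e, ∀ᶠ y in l x, D.SameCell q (x, y) := by
  have key : ∀ x ∈ D.span e, ∀ x' ∈ D.span e, ∃ T ⊆ D.free, IsPreconnected T ∧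
      (∀ᶠ y in l x, (x, y) ∈ T) ∧ ∀ᶠ y in l x', (x', y) ∈ T := by
    intro x hx x' hx'
    -- Lying beside one connected free set is a local, symmetric and transitive relation between
    -- positions on the edge; transitivity holds because two such sets share points beside the
    -- middle position.
    refine IsPreconnected.induction₂ (s := D.span e) isPreconnected_Ioo
      (fun x x' => ∃ T ⊆ D.free, IsPreconnected T ∧
        (∀ᶠ y in l x, (x, y) ∈ T) ∧ ∀ᶠ y in l x', (x', y) ∈ T) ?_ ?_ ?_ hx hx'
    · intro x hx
      obtain ⟨T, hT, hTp, h⟩ := hl x hx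
      filter_upwards [mem_nhdsWithin_of_mem_nhds h] with x' hx'
      exact ⟨T, hT, hTp, h.self_of_nhds, hx'⟩
    · rintro x y z - - - ⟨T, hT, hTp, h1, h2⟩ ⟨U, hU, hUp, h3, h4⟩
      obtain ⟨b, hb, hb'⟩ := (h2.and h3).exists
      exact ⟨T ∪ U, union_subset hT hU, IsPreconnected.union _ hb hb' hTp hUp,
        h1.mono fun _ h => Or.inl h, h4.mono fun _ h => Or.inr h⟩
    · rintro x y - - ⟨T, hT, hTp, h1, h2⟩
      exact ⟨T, hT, hTp, h2, h1⟩
  obtain ⟨x₀, hx₀⟩ : (D.span e).Nonempty := nonempty_Ioo.2 (D.pos_src_lt e)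
  obtain ⟨T, hT, hTp, h, -⟩ := key x₀ hx₀ x₀ hx₀
  obtain ⟨y₀, hy₀⟩ := h.exists
  refine ⟨(x₀, y₀), fun x hx => ?_⟩
  obtain ⟨U, hU, hUp, h1, h2⟩ := key x₀ hx₀ x hx
  obtain ⟨b, hb, hb'⟩ := (h.and h1).exists
  filter_upwards [h2] with y hy
  exact SameCell.trans ⟨T, hT, hTp, hy₀, hb⟩ ⟨U, hU, hUp, hb', hy⟩

theorem exists_upPoint [Finite E] (e : E) : ∃ q, ∀ x ∈ D.span e, ∀ᶠ y in 𝓝[>] (D.ext e x),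
    D.SameCell q (x, y) :=
  D.exists_cell_along e _ fun _ hx₀ =>
    let ⟨T, hT, _, _, hTp, _, h⟩ := D.exists_local_cells e hx₀
    ⟨T, hT, hTp, h.mono fun _ => And.left⟩

theorem exists_downPoint [Finite E] (e : E) : ∃ q, ∀ x ∈ D.span e, ∀ᶠ y in 𝓝[<] (D.ext e x),
    D.SameCell q (x, y) :=
  D.exists_cell_along e _ fun _ hx₀ =>
    let ⟨_, _, U, hU, _, hUp, h⟩ := D.exists_local_cells e hx₀
    ⟨U, hU, hUp, h.mono fun _ => And.right⟩

/-- A point in the cell directly above an edge. -/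
noncomputable def upPoint [Finite E] (e : E) : ℝ × ℝ := (D.exists_upPoint e).choose

/-- A point in the cell directly below an edge. -/
noncomputable def downPoint [Finite E] (e : E) : ℝ × ℝ := (D.exists_downPoint e).choose

theorem sameCell_upPoint [Finite E] {e : E} {x : ℝ} (hx : x ∈ D.span e) :
    ∀ᶠ y in 𝓝[>] (D.ext e x), D.SameCell (D.upPoint e) (x, y) :=
  (D.exists_upPoint e).choose_spec x hx

theorem sameCell_downPoint [Finite E] {e : E} {x : ℝ} (hx : x ∈ D.span e) :
    ∀ᶠ y in 𝓝[<] (D.ext e x), D.SameCell (D.downPoint e) (x, y) :=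
  (D.exists_downPoint e).choose_spec x hx

theorem upPoint_mem_free [Finite E] (e : E) : D.upPoint e ∈ D.free := by
  obtain ⟨x, hx⟩ : (D.span e).Nonempty := nonempty_Ioo.2 (D.pos_src_lt e)
  exact (D.sameCell_upPoint hx).exists.choose_spec.left_mem

theorem downPoint_mem_free [Finite E] (e : E) : D.downPoint e ∈ D.free := by
  obtain ⟨x, hx⟩ : (D.span e).Nonempty := nonempty_Ioo.2 (D.pos_src_lt e)
  exact (D.sameCell_downPoint hx).exists.choose_spec.left_mem

/-- Discrete intermediate value property on vertical lines. -/
theorem exists_crossing [Finite E] {S : ℝ × ℝ → Prop}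
    (hS : ∀ q q', D.SameCell q q' → (S q ↔ S q')) {x : ℝ} (hx : x ∈ D.strip)
    (hg : ∀ v, x ≠ D.pos v) {a b : ℝ} (hab : a ≤ b) (ha : (x, a) ∈ D.free) (hb : (x, b) ∈ D.free)
    (hSa : ¬ S (x, a)) (hSb : S (x, b)) :
    ∃ e, x ∈ D.span e ∧ a < D.ext e x ∧ D.ext e x < b ∧ ¬ S (D.downPoint e) ∧
      S (D.upPoint e) := by
  classical
  -- The edges that cross the vertical segment; the induction is on their number. If there are none,
  -- the segment lies in one cell and `S` cannot change.
  let Z : ℝ → ℝ → Set E := fun a b => {e | x ∈ D.span e ∧ a < D.ext e x ∧ D.ext e x < b}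
  suffices ∀ k, ∀ a b, a ≤ b → (x, a) ∈ D.free → (x, b) ∈ D.free → ¬ S (x, a) → S (x, b) →
      (Z a b).ncard = k → ∃ e ∈ Z a b, ¬ S (D.downPoint e) ∧ S (D.upPoint e) by
    obtain ⟨e, ⟨h1, h2, h3⟩, h4, h5⟩ := this _ a b hab ha hb hSa hSb rfl
    exact ⟨e, h1, h2, h3, h4, h5⟩
  intro k
  induction k using Nat.strong_induction_on with
  | _ k ih =>
  intro a b hab ha hb hSa hSb hk
  rcases (Z a b).eq_empty_or_nonempty with hZ | ⟨e, he⟩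
  · refine absurd ((hS _ _ (D.sameCell_vertical hab fun y hy => ?_)).2 hSb) hSa
    rcases hy.1.eq_or_lt with rfl | h1
    · exact ha
    rcases hy.2.eq_or_lt with rfl | h2
    · exact hb
    refine ⟨hx, ?_⟩
    rintro (⟨v, hv⟩ | ⟨e, he, hye⟩)
    · exact hg v (Prod.ext_iff.1 hv).1
    · have hxe : x ∈ D.span e := ⟨lt_of_le_of_ne he.1 (hg _).symm, lt_of_le_of_ne he.2 (hg _)⟩
      simp only at hye
      rw [← D.ext_of_mem_span hxe] at hye
      subst hye
      exact (hZ ▸ (⟨hxe, h1, h2⟩ : e ∈ Z a b) : e ∈ (∅ : Set E))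
  -- If `S` already holds just below `e`, the change happens lower down; if it still fails just
  -- above `e`, higher up. In both cases `e` drops out of the segment.
  · by_cases hd : S (D.downPoint e)
    · obtain ⟨c, hc, hac, hce⟩ := ((D.sameCell_downPoint he.1).and
        (Ioo_mem_nhdsLT he.2.1)).exists
      have hsub : Z a c ⊆ Z a b := fun f hf => ⟨hf.1, hf.2.1, hf.2.2.trans (hce.trans he.2.2)⟩
      have hlt : (Z a c).ncard < k := hk ▸ ncard_lt_ncard ((ssubset_iff_of_subset hsub).2
        ⟨e, he, fun h => h.2.2.not_gt hce⟩) (toFinite _)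
      obtain ⟨f, hf, h⟩ := ih _ hlt a c hac.le ha hc.right_mem hSa ((hS _ _ hc).1 hd) rfl
      exact ⟨f, hsub hf, h⟩
    · by_cases hu : S (D.upPoint e)
      · exact ⟨e, he, hd, hu⟩
      · obtain ⟨c, hc, hec, hcb⟩ := ((D.sameCell_upPoint he.1).and
          (Ioo_mem_nhdsGT he.2.2)).exists
        have hsub : Z c b ⊆ Z a b := fun f hf => ⟨hf.1, he.2.1.trans (hec.trans hf.2.1), hf.2.2⟩
        have hlt : (Z c b).ncard < k := hk ▸ ncard_lt_ncard ((ssubset_iff_of_subset hsub).2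
          ⟨e, he, fun h => h.2.1.not_gt hec⟩) (toFinite _)
        obtain ⟨f, hf, h⟩ := ih _ hlt c b hcb.le hc.right_mem hb
          (fun h => hu ((hS _ _ hc).2 h)) hSb rfl
        exact ⟨f, hsub hf, h⟩

end FlowGraph.PlanarDrawing

namespace FlowGraph.PlanarDrawing

variable {n : ℕ} {E : Type*} {G : FlowGraph n E} (D : G.PlanarDrawing)

/-! ### Routes below points -/

/-- The route `p` passes below the point `q`. -/
def Under (p : List E) (q : ℝ × ℝ) : Prop := D.height p q.1 < q.2

variable {D}

theorem height_ne {p : List E} (hp : G.IsRoute p) {q : ℝ × ℝ} (hq : q ∈ D.free) :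
    D.height p q.1 ≠ q.2 := fun h => hq.2 (by
  have := D.height_mem_support hp hq.1
  rwa [h] at this)

/-- On a connected set the side can change only at a point of the route, and such a point belongs to
the drawing. -/
theorem SameCell.under_iff {p : List E} (hp : G.IsRoute p) {q q' : ℝ × ℝ} (h : D.SameCell q q') :
    D.Under p q ↔ D.Under p q' := by
  suffices ∀ {q q'}, D.SameCell q q' → D.Under p q → D.Under p q' from ⟨this h, this h.symm⟩
  rintro q q' ⟨T, hT, hTp, hq, hq'⟩ hu
  by_contra hu'
  obtain ⟨z, hz, hz'⟩ := hTp.intermediate_value₂ hq hq'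
    ((D.continuous_height p).comp continuous_fst).continuousOn continuous_snd.continuousOn
    hu.le (not_lt.1 hu')
  exact height_ne hp (hT hz) hz'

variable (D)

theorem under_upPoint_iff [Finite E] {p : List E} (hp : G.IsRoute p) {e : E} {x : ℝ}
    (hx : x ∈ D.span e) : D.Under p (D.upPoint e) ↔ D.height p x ≤ D.ext e x := by
  constructor
  · intro h
    by_contra! hlt
    obtain ⟨y, hy, hy'⟩ := ((D.sameCell_upPoint hx).and (Ioo_mem_nhdsGT hlt)).exists
    exact hy'.2.not_gt ((hy.under_iff hp).1 h)
  · intro h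
    obtain ⟨y, hy, hy'⟩ := ((D.sameCell_upPoint hx).and self_mem_nhdsWithin).exists
    exact (hy.under_iff hp).2 (lt_of_le_of_lt h hy')

theorem under_downPoint_iff [Finite E] {p : List E} (hp : G.IsRoute p) {e : E} {x : ℝ}
    (hx : x ∈ D.span e) : D.Under p (D.downPoint e) ↔ D.height p x < D.ext e x := by
  constructor
  · intro h
    obtain ⟨y, hy, hy'⟩ := ((D.sameCell_downPoint hx).and self_mem_nhdsWithin).exists
    exact lt_trans ((hy.under_iff hp).1 h) hy'
  · intro hlt
    obtain ⟨y, hy, hy'⟩ := ((D.sameCell_downPoint hx).and (Ioo_mem_nhdsLT hlt)).exists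
    exact (hy.under_iff hp).2 hy'.1

theorem span_nonempty (e : E) : (D.span e).Nonempty := nonempty_Ioo.2 (D.pos_src_lt e)

/-- Crossing an edge upwards changes the position relative to a route if and only if the edge is
on the route. -/
theorem under_upPoint_iff_or [Finite E] {p : List E} (hp : G.IsRoute p) (e : E) :
    D.Under p (D.upPoint e) ↔ D.Under p (D.downPoint e) ∨ e ∈ p := by
  obtain ⟨x, hx⟩ := D.span_nonempty e
  rw [D.under_upPoint_iff hp hx, D.under_downPoint_iff hp hx, ← D.height_eq_iff hp hx,
    le_iff_lt_or_eq]

theorem not_under_downPoint [Finite E] {p : List E} (hp : G.IsRoute p) {e : E} (he : e ∈ p) :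
    ¬ D.Under p (D.downPoint e) := by
  obtain ⟨x, hx⟩ := D.span_nonempty e
  rw [D.under_downPoint_iff hp hx, (D.height_eq_iff hp hx).2 he]
  exact lt_irrefl _

theorem under_upPoint [Finite E] {p : List E} (hp : G.IsRoute p) {e : E} (he : e ∈ p) :
    D.Under p (D.upPoint e) := (D.under_upPoint_iff_or hp e).2 (Or.inr he)

/-! ### Bounded regions -/

variable {D}

theorem SameCell.mem_of_mem {R : Set (ℝ × ℝ)} (hR : R ∈ D.regions) {q q' : ℝ × ℝ}
    (h : D.SameCell q q') (hq : q ∈ R) : q' ∈ R := by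
  obtain ⟨T, hT, hTp, h1, h2⟩ := h
  obtain ⟨r, -, rfl⟩ := hR
  rw [connectedComponentIn_eq hq]
  exact hTp.subset_connectedComponentIn h1 (fun z hz => (hT hz).2) h2

theorem mem_region_iff {R : Set (ℝ × ℝ)} (hR : R ∈ D.regions) {q q' : ℝ × ℝ}
    (h : D.SameCell q q') : q ∈ R ↔ q' ∈ R := ⟨h.mem_of_mem hR, h.symm.mem_of_mem hR⟩

theorem notMem_support_of_mem {R : Set (ℝ × ℝ)} (hR : R ∈ D.regions) {q : ℝ × ℝ} (hq : q ∈ R) :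
    q ∉ D.support := by
  obtain ⟨r, -, rfl⟩ := hR
  exact connectedComponentIn_subset _ _ hq

theorem region_eq {R R' : Set (ℝ × ℝ)} (hR : R ∈ D.regions) (hR' : R' ∈ D.regions) {q : ℝ × ℝ}
    (hq : q ∈ R) (hq' : q ∈ R') : R = R' := by
  obtain ⟨r, -, rfl⟩ := hR
  obtain ⟨r', -, rfl⟩ := hR'
  rw [connectedComponentIn_eq hq, connectedComponentIn_eq hq']

/-- Otherwise the whole vertical ray above `q` would belong to the region of `q`, which is bounded.
-/
theorem exists_support_above {R : Set (ℝ × ℝ)} (hR : R ∈ D.regions) (hb : Bornology.IsBounded R)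
    {q : ℝ × ℝ} (hq : q ∈ R) : ∃ y, q.2 < y ∧ (q.1, y) ∈ D.support := by
  by_contra! h
  have hq' := notMem_support_of_mem hR hq
  have hsub : {q.1} ×ˢ Ici q.2 ⊆ R := by
    obtain ⟨r, -, rfl⟩ := hR
    rw [connectedComponentIn_eq hq]
    refine (isPreconnected_singleton.prod isPreconnected_Ici).subset_connectedComponentIn
      ⟨rfl, self_mem_Ici⟩ ?_
    rintro ⟨x, y⟩ ⟨hx, hy⟩
    obtain rfl : x = q.1 := hx
    rcases (show q.2 ≤ y from hy).eq_or_lt with rfl | hlt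
    · exact hq'
    · exact h y hlt
  obtain ⟨r, hr⟩ := hb.subset_closedBall 0
  have hmem := hr (hsub (show (q.1, max q.2 (r + 1)) ∈ {q.1} ×ˢ Ici q.2 from
    ⟨rfl, mem_Ici.2 (le_max_left _ _)⟩))
  rw [mem_closedBall_zero_iff, Prod.norm_def] at hmem
  have h1 := (le_max_right _ _).trans hmem
  have h2 := (Real.le_norm_self _).trans h1
  have h3 := (le_max_right q.2 (r + 1)).trans h2
  linarith

theorem exists_support_below {R : Set (ℝ × ℝ)} (hR : R ∈ D.regions) (hb : Bornology.IsBounded R)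
    {q : ℝ × ℝ} (hq : q ∈ R) : ∃ y, y < q.2 ∧ (q.1, y) ∈ D.support := by
  by_contra! h
  have hq' := notMem_support_of_mem hR hq
  have hsub : {q.1} ×ˢ Iic q.2 ⊆ R := by
    obtain ⟨r, -, rfl⟩ := hR
    rw [connectedComponentIn_eq hq]
    refine (isPreconnected_singleton.prod isPreconnected_Iic).subset_connectedComponentIn
      ⟨rfl, self_mem_Iic⟩ ?_
    rintro ⟨x, y⟩ ⟨hx, hy⟩
    obtain rfl : x = q.1 := hx
    rcases (show y ≤ q.2 from hy).eq_or_lt with rfl | hlt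
    · exact hq'
    · exact h y hlt
  obtain ⟨r, hr⟩ := hb.subset_closedBall 0
  have hmem := hr (hsub (show (q.1, min q.2 (-(r + 1))) ∈ {q.1} ×ˢ Iic q.2 from
    ⟨rfl, mem_Iic.2 (min_le_left _ _)⟩))
  rw [mem_closedBall_zero_iff, Prod.norm_def] at hmem
  have h1 := (le_max_right _ _).trans hmem
  have h2 := (neg_le_abs _).trans h1
  have h3 := min_le_right q.2 (-(r + 1))
  simp only at h2
  linarith

theorem eq_zero_of_mem_support {x y : ℝ} (h : (x, y) ∈ D.support) (hx : x ∉ D.strip) : y = 0 := by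
  rcases h with ⟨v, hv⟩ | ⟨e, he, hy⟩
  · exact (Prod.ext_iff.1 hv).2
  · simp only at he hy
    rw [← D.ext_of_mem he] at hy
    rw [hy]
    rcases he.1.eq_or_lt with h1 | h1
    · exact D.ext_of_le h1.ge
    rcases he.2.eq_or_lt with h2 | h2
    · exact D.ext_of_ge h2.ge
    · exact absurd (D.span_subset_strip e ⟨h1, h2⟩) hx

theorem exists_route_height (hG : G.Passable) {x y : ℝ} (h : (x, y) ∈ D.support)
    (hx : x ∈ D.strip) : ∃ p, G.IsRoute p ∧ D.height p x = y := by
  rcases h with ⟨v, hv⟩ | ⟨e, he, hy⟩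
  · obtain ⟨rfl, rfl⟩ := Prod.ext_iff.1 hv
    simp only at hx ⊢
    obtain ⟨e, rfl⟩ := hG.2 v (by rintro rfl; exact lt_irrefl _ hx.1)
    obtain ⟨p, hp, hep⟩ := hG.exists_route e
    exact ⟨p, hp, by rw [D.height_eq_ext hp hep ⟨(D.pos_src_lt e).le, le_rfl⟩,
      D.ext_of_ge le_rfl]⟩
  · obtain ⟨p, hp, hep⟩ := hG.exists_route e
    simp only at hy he
    exact ⟨p, hp, by rw [D.height_eq_ext hp hep he, D.ext_of_mem he, hy]⟩

/-- Points of bounded regions are above some route and below another one. -/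
theorem between_of_mem (hG : G.Passable) {R : Set (ℝ × ℝ)} (hR : R ∈ D.regions)
    (hb : Bornology.IsBounded R) {q : ℝ × ℝ} (hq : q ∈ R) :
    q ∈ D.free ∧ (∃ p, G.IsRoute p ∧ D.Under p q) ∧ ∃ p, G.IsRoute p ∧ ¬ D.Under p q := by
  obtain ⟨y, hy, hys⟩ := exists_support_above hR hb hq
  obtain ⟨z, hz, hzs⟩ := exists_support_below hR hb hq
  -- Outside the open strip the drawing has only points of height zero, hence none both above and
  -- below `q`.
  have hx : q.1 ∈ D.strip := by
    by_contra hx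
    rw [eq_zero_of_mem_support hys hx] at hy
    rw [eq_zero_of_mem_support hzs hx] at hz
    exact lt_asymm hy hz
  refine ⟨⟨hx, notMem_support_of_mem hR hq⟩, ?_, ?_⟩
  · obtain ⟨p, hp, hpz⟩ := exists_route_height hG hzs hx
    exact ⟨p, hp, by rwa [Under, hpz]⟩
  · obtain ⟨p, hp, hpy⟩ := exists_route_height hG hys hx
    exact ⟨p, hp, by rw [Under, hpy]; exact hy.not_gt⟩

/-- The component of `q` cannot leave the open set enclosed between `p` and `p'`: a limit point
outside this set lies on one of the routes, or over an end of the strip, where both routes have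
height zero and the only limit point possible is the source or the sink. -/
theorem isBounded_of_between {q : ℝ × ℝ} (hq : q ∈ D.free) {p p' : List E} (hp : G.IsRoute p)
    (hp' : G.IsRoute p') (hpq : D.Under p q) (hpq' : ¬ D.Under p' q) :
    Bornology.IsBounded (connectedComponentIn D.supportᶜ q) := by
  set U : Set (ℝ × ℝ) := {z | z.1 ∈ D.strip ∧ D.height p z.1 < z.2 ∧ z.2 < D.height p' z.1}
  have hc : Continuous fun z : ℝ × ℝ => D.height p z.1 := (D.continuous_height p).comp continuous_fst
  have hc' : Continuous fun z : ℝ × ℝ => D.height p' z.1 :=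
    (D.continuous_height p').comp continuous_fst
  have hqU : q ∈ U := ⟨hq.1, hpq, lt_of_le_of_ne (not_lt.1 hpq') (height_ne hp' hq).symm⟩
  have hU : IsOpen U := (isOpen_Ioo.preimage continuous_fst).inter
    ((isOpen_lt hc continuous_snd).inter (isOpen_lt continuous_snd hc'))
  have hcl : closure U ⊆ {z | z.1 ∈ Icc (D.pos 0) (D.pos (Fin.last (n + 1))) ∧
      D.height p z.1 ≤ z.2 ∧ z.2 ≤ D.height p' z.1} := by
    refine closure_minimal (fun z hz => ⟨⟨hz.1.1.le, hz.1.2.le⟩, hz.2.1.le, hz.2.2.le⟩) ?_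
    exact (isClosed_Icc.preimage continuous_fst).inter
      ((isClosed_le hc continuous_snd).inter (isClosed_le continuous_snd hc'))
  have hsub : connectedComponentIn D.supportᶜ q ⊆ U := by
    refine isPreconnected_connectedComponentIn.subset_of_closure_inter_subset hU
      ⟨q, mem_connectedComponentIn hq.2, hqU⟩ ?_
    rintro z ⟨hz, hzc⟩
    have hzs : z ∉ D.support := connectedComponentIn_subset _ _ hzc
    obtain ⟨h1, h2, h3⟩ := hcl hz
    have hx : z.1 ∈ D.strip := by
      rcases h1.1.eq_or_lt with h0 | h0
      · rw [D.height_of_le hp h0.ge] at h2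
        rw [D.height_of_le hp' h0.ge] at h3
        exact absurd (Or.inl ⟨0, Prod.ext h0.symm (le_antisymm h3 h2)⟩) hzs
      rcases h1.2.eq_or_lt with h4 | h4
      · rw [D.height_of_ge hp h4.ge] at h2
        rw [D.height_of_ge hp' h4.ge] at h3
        exact absurd (Or.inl ⟨_, Prod.ext h4 (le_antisymm h3 h2)⟩) hzs
      exact ⟨h0, h4⟩
    exact ⟨hx, lt_of_le_of_ne h2 (height_ne hp ⟨hx, hzs⟩),
      lt_of_le_of_ne h3 (height_ne hp' ⟨hx, hzs⟩).symm⟩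
  obtain ⟨a, ha⟩ := (isCompact_Icc (a := D.pos 0) (b := D.pos (Fin.last (n + 1)))).bddBelow_image
    (D.continuous_height p).continuousOn
  obtain ⟨b, hb⟩ := (isCompact_Icc (a := D.pos 0) (b := D.pos (Fin.last (n + 1)))).bddAbove_image
    (D.continuous_height p').continuousOn
  refine ((Metric.isBounded_Icc (D.pos 0) (D.pos (Fin.last (n + 1)))).prod
    (Metric.isBounded_Icc a b)).subset (hsub.trans fun z hz => ?_)
  have h1 : z.1 ∈ Icc (D.pos 0) (D.pos (Fin.last (n + 1))) := ⟨hz.1.1.le, hz.1.2.le⟩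
  exact ⟨h1, (ha ⟨_, h1, rfl⟩).trans hz.2.1.le, hz.2.2.le.trans (hb ⟨_, h1, rfl⟩)⟩

theorem exists_boundedRegion {q : ℝ × ℝ} (hq : q ∈ D.free) {p p' : List E} (hp : G.IsRoute p)
    (hp' : G.IsRoute p') (hpq : D.Under p q) (hpq' : ¬ D.Under p' q) :
    ∃ A : D.BoundedRegion, q ∈ A.1 :=
  ⟨⟨_, ⟨q, hq.2, rfl⟩, isBounded_of_between hq hp hp' hpq hpq'⟩, mem_connectedComponentIn hq.2⟩

namespace BoundedRegion

variable (A B : D.BoundedRegion)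

theorem eq_of_mem {A B : D.BoundedRegion} {q : ℝ × ℝ} (hA : q ∈ A.1) (hB : q ∈ B.1) : A = B :=
  Subtype.ext (region_eq A.2.1 B.2.1 hA hB)

/-- A bounded region stays within the strip, so the region itself is a connected free set. -/
theorem sameCell (hG : G.Passable) {q q' : ℝ × ℝ} (hq : q ∈ A.1) (hq' : q' ∈ A.1) :
    D.SameCell q q' := by
  refine ⟨A.1, fun z hz => (between_of_mem hG A.2.1 A.2.2 hz).1, ?_, hq, hq'⟩
  obtain ⟨r, -, hr⟩ := A.2.1
  rw [hr]
  exact isPreconnected_connectedComponentIn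

/-- Regions are open and there are finitely many vertices, so a small horizontal shift suffices. On
such vertical lines the drawing is met only at interior points of edges. -/
theorem exists_generic_mem [Finite E] : ∃ q ∈ A.1, ∀ v, q.1 ≠ D.pos v := by
  obtain ⟨r, hr, hA⟩ := A.2.1
  have hopen : IsOpen A.1 := hA ▸ D.isClosed_support.isOpen_compl.connectedComponentIn
  have hrA : r ∈ A.1 := hA ▸ mem_connectedComponentIn hr
  have h1 : ∀ᶠ x in 𝓝 r.1, (x, r.2) ∈ A.1 :=
    (Continuous.prodMk_left r.2).continuousAt.eventually (hopen.mem_nhds hrA)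
  have h2 : ∀ᶠ x in 𝓝[≠] r.1, ∀ v, x ≠ D.pos v := by
    refine eventually_all.2 fun v => ?_
    by_cases h : r.1 = D.pos v
    · rw [← h]
      exact self_mem_nhdsWithin
    · exact mem_nhdsWithin_of_mem_nhds (isOpen_ne.mem_nhds h)
  obtain ⟨x, hx1, hx2⟩ := ((h1.filter_mono nhdsWithin_le_nhds).and h2).exists
  exact ⟨_, hx1, hx2⟩

end BoundedRegion

/-- All points directly above an edge lie in one cell, so a single representative point decides. -/
theorem bordersAbove_iff [Finite E] {R : Set (ℝ × ℝ)} (hR : R ∈ D.regions) (e : E) :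
    D.BordersAbove R e ↔ D.upPoint e ∈ R := by
  constructor
  · rintro ⟨x, hx, h⟩
    rw [← D.ext_of_mem_span hx] at h
    obtain ⟨y, hy, hy'⟩ := ((D.sameCell_upPoint hx).and h).exists
    exact hy.symm.mem_of_mem hR hy'
  · intro h
    obtain ⟨x, hx⟩ := D.span_nonempty e
    refine ⟨x, hx, ?_⟩
    rw [← D.ext_of_mem_span hx]
    exact (D.sameCell_upPoint hx).mono fun y hy => hy.mem_of_mem hR h

theorem bordersBelow_iff [Finite E] {R : Set (ℝ × ℝ)} (hR : R ∈ D.regions) (e : E) :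
    D.BordersBelow R e ↔ D.downPoint e ∈ R := by
  constructor
  · rintro ⟨x, hx, h⟩
    rw [← D.ext_of_mem_span hx] at h
    obtain ⟨y, hy, hy'⟩ := ((D.sameCell_downPoint hx).and h).exists
    exact hy.symm.mem_of_mem hR hy'
  · intro h
    obtain ⟨x, hx⟩ := D.span_nonempty e
    refine ⟨x, hx, ?_⟩
    rw [← D.ext_of_mem_span hx]
    exact (D.sameCell_downPoint hx).mono fun y hy => hy.mem_of_mem hR h

theorem dualEdge_iff [Finite E] {A B : D.BoundedRegion} {e : E} :
    D.DualEdge e A B ↔ D.downPoint e ∈ A.1 ∧ D.upPoint e ∈ B.1 :=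
  and_congr (bordersBelow_iff A.2.1 e) (bordersAbove_iff B.2.1 e)

theorem DualEdge.le {A B : D.BoundedRegion} {e : E} (h : D.DualEdge e A B) : A ≤ B :=
  Relation.ReflTransGen.single ⟨e, h⟩

/-- Low points of vertical lines. -/
theorem exists_low_point [Finite E] {x : ℝ} (hx : x ∈ D.strip) (hg : ∀ v, x ≠ D.pos v) (b : ℝ) :
    ∃ a ≤ b, (x, a) ∈ D.free ∧ ∀ p, G.IsRoute p → ¬ D.Under p (x, a) := by
  obtain ⟨m, hm⟩ := (finite_range fun e => D.ext e x).bddBelow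
  have hlt : ∀ e, min b (m - 1) < D.ext e x := fun e =>
    (min_le_right _ _).trans_lt ((sub_one_lt m).trans_le (hm ⟨e, rfl⟩))
  refine ⟨min b (m - 1), min_le_left _ _, ⟨hx, ?_⟩, fun p hp h => ?_⟩
  · rintro (⟨v, hv⟩ | ⟨e, he, hy⟩)
    · exact hg v (Prod.ext_iff.1 hv).1
    · simp only at he hy
      rw [← D.ext_of_mem he] at hy
      exact (hlt e).ne hy
  · obtain ⟨e, he, hxe⟩ := D.exists_mem_Icc_of_isRoute hp hx
    rw [Under, D.height_eq_ext hp he hxe] at h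
    exact lt_asymm h (hlt e)

namespace BoundedRegion

/-- Some edge is crossed into `A` on a vertical line that comes up from a point below all routes, as
such a point is in no bounded region. -/
theorem exists_lower_edge [Finite E] (hG : G.Passable) (A : D.BoundedRegion) :
    ∃ e, D.upPoint e ∈ A.1 ∧ D.downPoint e ∉ A.1 := by
  obtain ⟨⟨x, b⟩, hq, hg⟩ := A.exists_generic_mem
  obtain ⟨hf, -, -⟩ := between_of_mem hG A.2.1 A.2.2 hq
  obtain ⟨a, hab, haf, ha⟩ := exists_low_point hf.1 hg b
  obtain ⟨e, -, -, -, h1, h2⟩ := D.exists_crossing (S := (· ∈ A.1))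
    (fun q q' h => mem_region_iff A.2.1 h) hf.1 hg hab haf hf (fun h => by
      obtain ⟨-, ⟨p, hp, hp'⟩, -⟩ := between_of_mem hG A.2.1 A.2.2 h
      exact ha p hp hp') hq
  exact ⟨e, h2, h1⟩

/-- A region is determined by any edge that it lies directly above, so regions inject into edges. -/
theorem finite [Finite E] (hG : G.Passable) : Finite D.BoundedRegion := by
  choose f hf _ using exists_lower_edge (D := D) hG
  exact Finite.of_injective f fun A B h => eq_of_mem (hf A) (h ▸ hf B)

end BoundedRegion

/-! ### Regions above a route and the order of regions -/

variable (D) in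
/-- The bounded regions above a route. -/
def regionsAbove (p : List E) : Set D.BoundedRegion := {A | ∃ q ∈ A.1, D.Under p q}

theorem mem_regionsAbove_iff (hG : G.Passable) {p : List E} (hp : G.IsRoute p)
    {A : D.BoundedRegion} {q : ℝ × ℝ} (hq : q ∈ A.1) : A ∈ D.regionsAbove p ↔ D.Under p q :=
  ⟨fun ⟨_, hq', h⟩ => ((A.sameCell hG hq' hq).under_iff hp).1 h, fun h => ⟨q, hq, h⟩⟩

theorem isUpperSet_regionsAbove [Finite E] (hG : G.Passable) {p : List E} (hp : G.IsRoute p) :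
    IsUpperSet (D.regionsAbove p) := by
  intro A B hAB hA
  induction hAB with
  | refl => exact hA
  | tail _ h ih =>
    obtain ⟨e, he⟩ := h
    obtain ⟨h1, h2⟩ := dualEdge_iff.1 he
    rw [mem_regionsAbove_iff hG hp h2, D.under_upPoint_iff_or hp]
    exact Or.inl ((mem_regionsAbove_iff hG hp h1).1 ih)

/-- A route through the first dual edge of a cycle has the next region above it but not `A`,
although the regions above it form an up-set. -/
theorem BoundedRegion.le_antisymm [Finite E] (hG : G.Passable) (A B : D.BoundedRegion)
    (hAB : A ≤ B) (hBA : B ≤ A) : A = B := by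
  rcases Relation.ReflTransGen.cases_head hAB with h | ⟨C, ⟨e, he⟩, hCB⟩
  · exact h
  · obtain ⟨p, hp, hep⟩ := hG.exists_route e
    obtain ⟨h1, h2⟩ := dualEdge_iff.1 he
    have hC : C ∈ D.regionsAbove p := (mem_regionsAbove_iff hG hp h2).2 (D.under_upPoint hp hep)
    have hA := isUpperSet_regionsAbove hG hp (show C ≤ A from hCB.trans hBA) hC
    exact absurd ((mem_regionsAbove_iff hG hp h1).1 hA) (D.not_under_downPoint hp hep)

/-- Regions on a vertical line are comparable. -/
theorem BoundedRegion.le_of_vertical [Finite E] (hG : G.Passable) {A B : D.BoundedRegion}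
    {x a b : ℝ} (hg : ∀ v, x ≠ D.pos v) (hab : a ≤ b) (hA : (x, a) ∈ A.1) (hB : (x, b) ∈ B.1) :
    A ≤ B := by
  by_contra hAB
  obtain ⟨hf, ⟨p, hp, hpa⟩, -⟩ := between_of_mem hG A.2.1 A.2.2 hA
  obtain ⟨hf', -, p', hp', hpb⟩ := between_of_mem hG B.2.1 B.2.2 hB
  -- The property followed upwards is that of not lying in a region `≥ A`. Where it starts to hold,
  -- an edge has a region `≥ A` below it. The region above that edge is bounded, because it lies
  -- between `p`, which is below `(x, a)`, and `p'`, which is above `(x, b)`; so it is `≥ A` as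
  -- well.
  obtain ⟨e, hxe, hae, heb, h1, h2⟩ := D.exists_crossing
    (S := fun q => ¬ ∃ C : D.BoundedRegion, q ∈ C.1 ∧ A ≤ C)
    (fun q q' h => not_congr (exists_congr fun C => and_congr_left fun _ =>
      mem_region_iff C.2.1 h)) hf.1 hg hab hf hf' (fun h => h ⟨A, hA, le_refl A⟩)
    (fun ⟨C, hC, hAC⟩ => hAB (BoundedRegion.eq_of_mem hC hB ▸ hAC))
  obtain ⟨C, hC, hAC⟩ := not_not.1 h1
  have hu : D.Under p (D.upPoint e) :=
    (D.under_upPoint_iff hp hxe).2 ((show D.height p x < a from hpa).trans hae).le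
  have hu' : ¬ D.Under p' (D.upPoint e) := by
    rw [D.under_upPoint_iff hp' hxe, not_le]
    exact heb.trans_le (not_lt.1 hpb)
  obtain ⟨C', hC'⟩ := exists_boundedRegion (D.upPoint_mem_free e) hp hp' hu hu'
  exact h2 ⟨C', hC', hAC.trans (dualEdge_iff.2 ⟨hC, hC'⟩ : D.DualEdge e C C').le⟩

/-- Descend through lower edges: the region below is either unbounded, where a dual path may start,
or strictly smaller in the finite poset. -/
theorem nonempty_lowPaths [Finite E] (hG : G.Passable) : Nonempty D.LowPaths := by
  have := BoundedRegion.finite (D := D) hG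
  suffices ∀ A : D.BoundedRegion, ∃ l, D.IsLowPath A l from
    ⟨fun A => ⟨(this A).choose, (this A).choose_spec⟩⟩
  have hwf : WellFounded ((· < ·) : D.BoundedRegion → D.BoundedRegion → Prop) :=
    Finite.wellFounded_of_trans_of_irrefl _
  intro A
  induction A using hwf.induction with
  | _ A ih =>
    obtain ⟨e, hu, hd⟩ := A.exists_lower_edge hG
    have hreg : connectedComponentIn D.supportᶜ (D.downPoint e) ∈ D.regions :=
      ⟨_, (D.downPoint_mem_free e).2, rfl⟩
    have hmem := mem_connectedComponentIn (F := D.supportᶜ) (D.downPoint_mem_free e).2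
    by_cases hb : Bornology.IsBounded (connectedComponentIn D.supportᶜ (D.downPoint e))
    · let B : D.BoundedRegion := ⟨_, hreg, hb⟩
      have hBA : D.DualEdge e B A := dualEdge_iff.2 ⟨hmem, hu⟩
      have hlt : B < A := lt_of_le_not_ge hBA.le fun h => by
        have := BoundedRegion.le_antisymm hG _ _ hBA.le h
        exact hd (this ▸ hmem)
      obtain ⟨l, hl⟩ := ih B hlt
      exact ⟨_, .step B A e l hl hBA⟩
    · exact ⟨_, .start _ e A hreg hb ((bordersBelow_iff hreg e).2 hmem)
        ((bordersAbove_iff A.2.1 e).2 hu)⟩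

/-- Along an upward dual path the side with respect to `p` changes exactly at the edges of `p`,
always from below to above, so the sum counts at most one crossing. -/
theorem flowToOrder_routeFlow [Finite E] (hG : G.Passable) (c : D.LowPaths) {p : List E}
    (hp : G.IsRoute p) :
    D.flowToOrder c (G.routeFlow p) = (D.regionsAbove p).indicator 1 := by
  classical
  suffices ∀ A l, D.IsLowPath A l →
      (l.map (G.routeFlow p)).sum = (D.regionsAbove p).indicator 1 A from
    funext fun A => this A _ (c A).2
  have hind : ∀ A : D.BoundedRegion, ∀ e, D.upPoint e ∈ A.1 →
      (D.regionsAbove p).indicator (1 : D.BoundedRegion → ℝ) A =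
        G.routeFlow p e + if D.Under p (D.downPoint e) then 1 else 0 := by
    intro A e hu
    have h := (mem_regionsAbove_iff hG hp hu).trans (D.under_upPoint_iff_or hp e)
    by_cases hep : e ∈ p
    · simp [h, hep, routeFlow, D.not_under_downPoint hp hep]
    · by_cases hd : D.Under p (D.downPoint e) <;> simp [indicator, h, hep, routeFlow, hd]
  intro A l h
  induction h with
  | start R e A hR hb h1 h2 =>
    rw [bordersBelow_iff hR] at h1
    rw [bordersAbove_iff A.2.1] at h2
    rw [hind A e h2, if_neg]
    · simp
    -- The start is not above `p`: a route through `e` runs above it, so it would be enclosed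
    -- between two routes and its region would be bounded.
    · intro hd
      obtain ⟨p', hp', hep'⟩ := hG.exists_route e
      apply hb
      rw [region_eq hR ⟨_, (D.downPoint_mem_free e).2, rfl⟩ h1
        (mem_connectedComponentIn (D.downPoint_mem_free e).2)]
      exact isBounded_of_between (D.downPoint_mem_free e) hp hp' hd
        (D.not_under_downPoint hp' hep')
  | step A B e l _ h ih =>
    obtain ⟨h1, h2⟩ := dualEdge_iff.1 h
    rw [List.map_cons, List.sum_cons, ih, hind B e h2]
    congr 1
    simp [indicator, mem_regionsAbove_iff hG hp h1]

end FlowGraph.PlanarDrawing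

namespace FlowGraph.PlanarDrawing

variable {n : ℕ} {E : Type*} {G : FlowGraph n E} {D : G.PlanarDrawing}

/-! ### The route below an up-set of regions -/

/-- The points in the regions of an up-set, where the unbounded region above the drawing is
added to the up-set. -/
def InUpper (F : Set D.BoundedRegion) (q : ℝ × ℝ) : Prop :=
  (∃ p, G.IsRoute p ∧ D.Under p q) ∧
    ((∀ p, G.IsRoute p → D.Under p q) ∨ ∃ A ∈ F, q ∈ A.1)

theorem inUpper_iff_of_sameCell (F : Set D.BoundedRegion) (q q' : ℝ × ℝ) (h : D.SameCell q q') :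
    InUpper F q ↔ InUpper F q' := by
  refine and_congr (exists_congr fun p => and_congr_right fun hp => h.under_iff hp)
    (or_congr (forall_congr' fun p => imp_congr_right fun hp => h.under_iff hp)
      (exists_congr fun A => and_congr_right fun _ => mem_region_iff A.2.1 h))

/-- A higher point is above all routes or in a bounded region, and then this region is at least the
one below it on the same vertical line. -/
theorem InUpper.mono_vertical [Finite E] (hG : G.Passable) {F : Set D.BoundedRegion}
    (hF : IsUpperSet F) {x a b : ℝ} (hg : ∀ v, x ≠ D.pos v) (hab : a ≤ b)
    (hb : (x, b) ∈ D.free) (h : InUpper F (x, a)) : InUpper F (x, b) := by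
  have hmono : ∀ p, D.Under p (x, a) → D.Under p (x, b) := fun p hp => lt_of_lt_of_le hp hab
  obtain ⟨⟨p, hp, hpa⟩, h⟩ := h
  refine ⟨⟨p, hp, hmono p hpa⟩, ?_⟩
  rcases h with h | ⟨A, hA, haA⟩
  · exact Or.inl fun p hp => hmono p (h p hp)
  · by_cases hall : ∀ p, G.IsRoute p → D.Under p (x, b)
    · exact Or.inl hall
    · push Not at hall
      obtain ⟨p', hp', hpb⟩ := hall
      obtain ⟨B, hB⟩ := exists_boundedRegion hb hp hp' (hmono p hpa) hpb
      exact Or.inr ⟨B, hF (BoundedRegion.le_of_vertical hG hg hab haA hB) hA, hB⟩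

theorem inUpper_iff_mem (hG : G.Passable) {F : Set D.BoundedRegion} {A : D.BoundedRegion}
    {q : ℝ × ℝ} (hq : q ∈ A.1) : InUpper F q ↔ A ∈ F := by
  obtain ⟨-, hp, p', hp', h'⟩ := between_of_mem hG A.2.1 A.2.2 hq
  constructor
  · rintro ⟨-, h | ⟨B, hB, hqB⟩⟩
    · exact absurd (h p' hp') h'
    · rwa [BoundedRegion.eq_of_mem hq hqB]
  · exact fun hA => ⟨hp, Or.inr ⟨A, hA, hq⟩⟩

/-! ### The lower boundary of an up-set near a vertex -/

/-- The edges on the lower boundary of an up-set. -/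
def lowerBoundary [Finite E] (F : Set D.BoundedRegion) : Set E :=
  {e | ¬ InUpper F (D.downPoint e) ∧ InUpper F (D.upPoint e)}

variable (D) in
/-- The conditions defining a box of half height `ε` around a vertex which is met only by the edges
that are incident with the vertex, on the vertical line at `x`. -/
def InBox (v : Fin (n + 2)) (ε x : ℝ) : Prop :=
  (∀ e, D.pos v ∈ D.span e → ε < |D.ext e x|) ∧
  (∀ e, D.pos v ∉ D.span e → x ∈ Icc (D.pos (G.src e)) (D.pos (G.tgt e)) →
    (G.src e = v ∨ G.tgt e = v) ∧ |D.ext e x| < ε) ∧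
  ∀ w, w ≠ v → x ≠ D.pos w

/-- At `v` itself the edges running over or under it have nonzero height and the edges incident with
it have height zero. There are finitely many edges, so one `ε` separates the two kinds, and by
continuity it still does so nearby. -/
theorem exists_box [Finite E] (v : Fin (n + 2)) :
    ∃ ε > 0, ∀ᶠ x in 𝓝 (D.pos v), D.InBox v ε x := by
  have h1 : ∀ᶠ ε in 𝓝[>] (0 : ℝ), ∀ e, D.pos v ∈ D.span e → ε < |D.ext e (D.pos v)| := by
    refine eventually_all.2 fun e => ?_
    by_cases h : D.pos v ∈ D.span e
    · have hne : 0 < |D.ext e (D.pos v)| := by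
        rw [abs_pos, D.ext_of_mem_span h]
        exact D.curve_ne_vertex e v h
      filter_upwards [Ioo_mem_nhdsGT hne] with ε hε _ using hε.2
    · exact Eventually.of_forall fun _ h' => absurd h' h
  obtain ⟨ε, hε, hε0⟩ := (h1.and self_mem_nhdsWithin).exists
  refine ⟨ε, hε0, ?_⟩
  have habs : ∀ e, ContinuousAt (fun x => |D.ext e x|) (D.pos v) := fun e =>
    (D.continuous_ext e).abs.continuousAt
  refine (eventually_all.2 fun e => ?_).and ((eventually_all.2 fun e => ?_).and
    (eventually_all.2 fun w => ?_))
  · by_cases h : D.pos v ∈ D.span e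
    · filter_upwards [(habs e).eventually (lt_mem_nhds (hε e h))] with x hx _ using hx
    · exact Eventually.of_forall fun _ h' => absurd h' h
  · by_cases h : D.pos v ∈ Icc (D.pos (G.src e)) (D.pos (G.tgt e))
    · by_cases hs : D.pos v ∈ D.span e
      · exact Eventually.of_forall fun _ h' => absurd hs h'
      · have hinc : G.src e = v ∨ G.tgt e = v := by
          by_contra! hne
          exact hs ⟨lt_of_le_of_ne h.1 (D.pos_strictMono.injective.ne hne.1),
            lt_of_le_of_ne h.2 (D.pos_strictMono.injective.ne hne.2.symm)⟩
        have h0 : |D.ext e (D.pos v)| < ε := by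
          rcases hinc with rfl | rfl
          · rwa [D.ext_of_le le_rfl, abs_zero]
          · rwa [D.ext_of_ge le_rfl, abs_zero]
        filter_upwards [(habs e).eventually (gt_mem_nhds h0)] with x hx _ _ using ⟨hinc, hx⟩
    · filter_upwards [isClosed_Icc.isOpen_compl.mem_nhds h] with x hx _ h' using absurd h' hx
  · by_cases h : w = v
    · exact Eventually.of_forall fun _ h' => absurd h h'
    · filter_upwards [isOpen_ne.mem_nhds (D.pos_strictMono.injective.ne (Ne.symm h))] with x hx _
        using hx

/-- The purpose of the box: its top and bottom sides avoid the drawing, so membership in an up-set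
is carried along them past the vertex. -/
theorem InBox.mem_free {v : Fin (n + 2)} {ε x : ℝ} (h : D.InBox v ε x) (hε : 0 < ε)
    (hx : x ∈ D.strip) {y : ℝ} (hy : |y| = ε) : (x, y) ∈ D.free := by
  refine ⟨hx, ?_⟩
  rintro (⟨w, hw⟩ | ⟨e, he, hey⟩)
  · obtain rfl : y = 0 := (Prod.ext_iff.1 hw).2
    rw [abs_zero] at hy
    exact hε.ne hy
  · simp only at he hey
    rw [← D.ext_of_mem he] at hey
    subst hey
    by_cases hs : D.pos v ∈ D.span e
    · exact (h.1 e hs).ne' hy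
    · exact (h.2.1 e hs he).2.ne hy

theorem InBox.generic {v : Fin (n + 2)} {ε x : ℝ} (h : D.InBox v ε x) (hx : x ≠ D.pos v) (w) :
    x ≠ D.pos w := by
  by_cases hw : w = v
  · rwa [hw]
  · exact h.2.2 w hw

/-- A boundary edge is crossed between the bottom and the top of the box. Inside the box only edges
incident with `v` occur, and to the right of `v` these start at `v`. -/
theorem exists_src_of_box [Finite E] {F : Set D.BoundedRegion} {v : Fin (n + 2)} {ε x : ℝ}
    (h : D.InBox v ε x) (hε : 0 < ε) (hx : x ∈ D.strip) (hvx : D.pos v < x)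
    (hl : ¬ InUpper F (x, -ε)) (hu : InUpper F (x, ε)) :
    ∃ f ∈ lowerBoundary F, G.src f = v := by
  obtain ⟨f, hxf, h1, h2, h3, h4⟩ := D.exists_crossing (inUpper_iff_of_sameCell F) hx
    (h.generic hvx.ne') (by linarith) (h.mem_free hε hx (by rw [abs_neg, abs_of_pos hε]))
    (h.mem_free hε hx (abs_of_pos hε)) hl hu
  have hs : D.pos v ∉ D.span f := fun hs => (h.1 f hs).not_gt (abs_lt.2 ⟨h1, h2⟩)
  refine ⟨f, ⟨h3, h4⟩, ?_⟩
  rcases (h.2.1 f hs ⟨hxf.1.le, hxf.2.le⟩).1 with h' | h'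
  · exact h'
  · rw [span, h'] at hxf
    exact absurd hxf.2 hvx.not_gt

/-- Near the source all routes run inside the box, so its top is above all of them and its bottom
below all of them, whatever `F` is. -/
theorem exists_first_edge [Finite E] (hG : G.Passable) (F : Set D.BoundedRegion) :
    ∃ f ∈ lowerBoundary F, G.src f = 0 := by
  obtain ⟨ε, hε, hev⟩ := D.exists_box 0
  have hlt : D.pos 0 < D.pos (Fin.last (n + 1)) := D.pos_strictMono Fin.last_pos
  obtain ⟨x, hbox, hx⟩ := ((hev.filter_mono nhdsWithin_le_nhds).and (Ioo_mem_nhdsGT hlt)).exists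
  have habs : ∀ p, G.IsRoute p → |D.height p x| < ε := by
    intro p hp
    obtain ⟨e, he, hxe⟩ := D.exists_mem_Icc_of_isRoute hp hx
    rw [D.height_eq_ext hp he hxe]
    exact (hbox.2.1 e (fun h => (D.span_subset_strip e h).1.false) hxe).2
  obtain ⟨p, hp, -⟩ := hG.exists_route hG.exists_edge.some
  refine exists_src_of_box hbox hε hx hx.1 ?_ ⟨⟨p, hp, (abs_lt.1 (habs p hp)).2⟩,
    Or.inl fun p hp => (abs_lt.1 (habs p hp)).2⟩
  rintro ⟨⟨p, hp, h⟩, -⟩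
  exact (abs_lt.1 (habs p hp)).1.not_gt h

/-- Just left of the vertex, monotonicity along the vertical line through `e` puts the bottom of the
box outside the up-set and its top inside. The free sides carry this to the right of the vertex,
where some boundary edge must leave. -/
theorem exists_next_edge [Finite E] (hG : G.Passable) {F : Set D.BoundedRegion}
    (hF : IsUpperSet F) {e : E} (he : e ∈ lowerBoundary F) (hl : G.tgt e ≠ Fin.last (n + 1)) :
    ∃ f ∈ lowerBoundary F, G.src f = G.tgt e := by
  obtain ⟨ε, hε, hev⟩ := D.exists_box (G.tgt e)
  have hstrip : D.pos (G.tgt e) ∈ D.strip :=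
    ⟨D.pos_strictMono ((Fin.zero_le _).trans_lt (G.src_lt_tgt e)),
      D.pos_strictMono (lt_of_le_of_ne (Fin.le_last _) hl)⟩
  obtain ⟨δ, hδ, hball⟩ := Metric.eventually_nhds_iff_ball.1
    (hev.and (IsOpen.eventually_mem (isOpen_Ioo : IsOpen D.strip) hstrip))
  rw [Real.ball_eq_Ioo] at hball
  obtain ⟨x₁, hx₁, hx₁'⟩ := exists_between
    (max_lt (D.pos_src_lt e) (sub_lt_self (D.pos (G.tgt e)) hδ))
  obtain ⟨hsx, hδx⟩ := max_lt_iff.1 hx₁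
  obtain ⟨x₂, hx₂, hx₂'⟩ := exists_between (lt_add_of_pos_right (D.pos (G.tgt e)) hδ)
  have hI : ∀ x ∈ Icc x₁ x₂, D.InBox (G.tgt e) ε x ∧ x ∈ D.strip := fun x hx =>
    hball x ⟨hδx.trans_le hx.1, hx.2.trans_lt hx₂'⟩
  have h12 : x₁ ≤ x₂ := (hx₁'.trans hx₂).le
  obtain ⟨hb1, hs1⟩ := hI x₁ ⟨le_rfl, h12⟩
  obtain ⟨hb2, hs2⟩ := hI x₂ ⟨h12, le_rfl⟩
  have hxe : x₁ ∈ D.span e := ⟨hsx, hx₁'⟩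
  obtain ⟨hlo, hhi⟩ := abs_lt.1
    (hb1.2.1 e (fun h => h.2.false) ⟨hxe.1.le, hxe.2.le⟩).2
  have hg := hb1.generic hx₁'.ne
  have hneg : |(-ε)| = ε := by rw [abs_neg, abs_of_pos hε]
  refine exists_src_of_box hb2 hε hs2 hx₂ (fun h => ?_) ?_
  · have h1 := (inUpper_iff_of_sameCell F _ _ (D.sameCell_horizontal h12 fun x hx =>
      (hI x hx).1.mem_free hε (hI x hx).2 hneg)).2 h
    obtain ⟨y, hy, hy'⟩ := ((D.sameCell_downPoint hxe).and (Ioo_mem_nhdsLT hlo)).exists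
    exact he.1 ((inUpper_iff_of_sameCell F _ _ hy).2
      (h1.mono_vertical hG hF hg hy'.1.le hy.right_mem))
  · obtain ⟨y, hy, hy'⟩ := ((D.sameCell_upPoint hxe).and (Ioo_mem_nhdsGT hhi)).exists
    refine (inUpper_iff_of_sameCell F _ _ (D.sameCell_horizontal h12 fun x hx =>
      (hI x hx).1.mem_free hε (hI x hx).2 (abs_of_pos hε))).1 ?_
    exact ((inUpper_iff_of_sameCell F _ _ hy).1 he.2).mono_vertical hG hF hg hy'.2.le
      (hb1.mem_free hε hs1 (abs_of_pos hε))

/-- Each up-set consists of the regions above some route. -/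
theorem exists_regionsAbove_eq [Finite E] (hG : G.Passable) {F : Set D.BoundedRegion}
    (hF : IsUpperSet F) : ∃ p, G.IsRoute p ∧ D.regionsAbove p = F := by
  obtain ⟨e, he, he0⟩ := exists_first_edge hG F
  obtain ⟨p', hp', hpF⟩ := exists_path_to_last
    (fun e he hl => exists_next_edge hG hF he hl) he
  have hp : G.IsRoute (e :: p') := ⟨he0, hp'⟩
  have hB : ∀ f ∈ e :: p', f ∈ lowerBoundary F := by simpa using ⟨he, hpF⟩
  generalize e :: p' = p at hp hB
  refine ⟨p, hp, ?_⟩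
  ext A
  -- A generic point of `A` lies above or below a single edge `f` of the route. The status on both
  -- sides of `f` is known, and monotonicity on the vertical line transfers it to the point.
  obtain ⟨⟨x, y⟩, hq, hg⟩ := A.exists_generic_mem
  obtain ⟨hf, -, -⟩ := between_of_mem hG A.2.1 A.2.2 hq
  obtain ⟨f, hfp, hxf⟩ := D.exists_mem_span_of_isRoute hp hf.1 hg
  have hh : D.height p x = D.ext f x := (D.height_eq_iff hp hxf).2 hfp
  rw [mem_regionsAbove_iff hG hp hq, ← inUpper_iff_mem hG hq, Under, hh]
  constructor
  · intro hlt
    obtain ⟨z, hz, hz'⟩ := ((D.sameCell_upPoint hxf).and (Ioo_mem_nhdsGT hlt)).exists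
    exact ((inUpper_iff_of_sameCell F _ _ hz).1 (hB f hfp).2).mono_vertical hG hF hg hz'.2.le hf
  · intro hin
    by_contra hle
    have hlt : y < D.ext f x := lt_of_le_of_ne (not_lt.1 hle) fun h =>
      height_ne hp hf (hh.trans h.symm)
    obtain ⟨z, hz, hz'⟩ := ((D.sameCell_downPoint hxf).and (Ioo_mem_nhdsLT hlt)).exists
    exact (hB f hfp).1 ((inUpper_iff_of_sameCell F _ _ hz).2
      (hin.mono_vertical hG hF hg hz'.1.le hz.right_mem))

/-- Inclusion of the up-sets of routes is the order of routes from top to bottom. -/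
theorem regionsAbove_subset_iff [Finite E] (hG : G.Passable) {p q : List E} (hp : G.IsRoute p)
    (hq : G.IsRoute q) :
    D.regionsAbove p ⊆ D.regionsAbove q ↔ ∀ x, D.height q x ≤ D.height p x := by
  constructor
  · intro h
    -- Where `q` is strictly higher than `p`, the region directly above the edge of `p` is bounded,
    -- above `p` and not above `q`. The ends of the edges follow by taking closures.
    have hspan : ∀ e ∈ p, ∀ x ∈ D.span e, D.height q x ≤ D.height p x := by
      intro e he x hx
      by_contra! hlt
      rw [(D.height_eq_iff hp hx).2 he] at hlt
      have hu : D.Under p (D.upPoint e) := D.under_upPoint hp he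
      have hu' : ¬ D.Under q (D.upPoint e) := by
        rw [D.under_upPoint_iff hq hx]
        exact hlt.not_ge
      obtain ⟨A, hA⟩ := exists_boundedRegion (D.upPoint_mem_free e) hp hq hu hu'
      exact hu' ((mem_regionsAbove_iff hG hq hA).1 (h ((mem_regionsAbove_iff hG hp hA).2 hu)))
    intro x
    by_cases hx : x ∈ D.strip
    · obtain ⟨e, he, hxe⟩ := D.exists_mem_Icc_of_isRoute hp hx
      have hcl : IsClosed {x | D.height q x ≤ D.height p x} :=
        isClosed_le (D.continuous_height q) (D.continuous_height p)
      have := closure_minimal (hspan e he) hcl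
      rw [span, closure_Ioo (D.pos_src_lt e).ne] at this
      exact this hxe
    · by_cases h0 : x ≤ D.pos 0
      · rw [D.height_of_le hp h0, D.height_of_le hq h0]
      · have hl : D.pos (Fin.last (n + 1)) ≤ x := not_lt.1 fun h => hx ⟨not_le.1 h0, h⟩
        rw [D.height_of_ge hp hl, D.height_of_ge hq hl]
  · rintro h A ⟨z, hz, hzp⟩
    exact ⟨z, hz, (h z.1).trans_lt hzp⟩

end FlowGraph.PlanarDrawing

/-! ### Coherent routes -/

/-- Two lists are equal, or one is a proper prefix of the other, or they branch somewhere. -/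
theorem List.eq_or_prefix_or_branch {α : Type*} (a b : List α) :
    a = b ∨ (∃ r, r ≠ [] ∧ a = b ++ r) ∨ (∃ r, r ≠ [] ∧ b = a ++ r) ∨
      ∃ s e f a' b', e ≠ f ∧ a = s ++ e :: a' ∧ b = s ++ f :: b' := by
  induction a generalizing b with
  | nil =>
    rcases b with _ | ⟨f, b⟩
    · exact Or.inl rfl
    · exact Or.inr (Or.inr (Or.inl ⟨f :: b, by simp, rfl⟩))
  | cons e a ih =>
    rcases b with _ | ⟨f, b⟩
    · exact Or.inr (Or.inl ⟨e :: a, by simp, rfl⟩)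
    · by_cases hef : e = f
      · subst hef
        rcases ih b with rfl | ⟨r, hr, rfl⟩ | ⟨r, hr, rfl⟩ | ⟨s, g, h, a', b', hne, rfl, rfl⟩
        · exact Or.inl rfl
        · exact Or.inr (Or.inl ⟨r, hr, rfl⟩)
        · exact Or.inr (Or.inr (Or.inl ⟨r, hr, rfl⟩))
        · exact Or.inr (Or.inr (Or.inr ⟨e :: s, g, h, a', b', hne, rfl, rfl⟩))
      · exact Or.inr (Or.inr (Or.inr ⟨[], e, f, a, b, hef, rfl, rfl⟩))

/-- Two lists are equal, or one is a proper suffix of the other, or they merge somewhere. -/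
theorem List.eq_or_suffix_or_merge {α : Type*} (a b : List α) :
    a = b ∨ (∃ r, r ≠ [] ∧ a = r ++ b) ∨ (∃ r, r ≠ [] ∧ b = r ++ a) ∨
      ∃ s e f a' b', e ≠ f ∧ a = a' ++ e :: s ∧ b = b' ++ f :: s := by
  rcases a.reverse.eq_or_prefix_or_branch b.reverse with
    h | ⟨r, hr, h⟩ | ⟨r, hr, h⟩ | ⟨s, e, f, a', b', hne, h1, h2⟩
  · exact Or.inl (List.reverse_injective h)
  · exact Or.inr (Or.inl ⟨r.reverse, by simpa using hr, List.reverse_injective (by simpa using h)⟩)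
  · exact Or.inr (Or.inr (Or.inl ⟨r.reverse, by simpa using hr,
      List.reverse_injective (by simpa using h)⟩))
  · exact Or.inr (Or.inr (Or.inr ⟨s.reverse, e, f, a'.reverse, b'.reverse, hne,
      List.reverse_injective (by simpa using h1), List.reverse_injective (by simpa using h2)⟩))

namespace FlowGraph.PlanarDrawing

variable {n : ℕ} {E : Type*} {G : FlowGraph n E} {D : G.PlanarDrawing}

theorem AboveOut.height_lt {u₁ u₂ v₁ v₂ v : Fin (n + 2)} {p q : List E} (hp : G.IsPath u₁ v₁ p)
    (hq : G.IsPath u₂ v₂ q) {e f : E} (he : e ∈ p) (hf : f ∈ q) (hev : G.src e = v)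
    (hfv : G.src f = v) (h : D.AboveOut v e f) :
    ∀ᶠ x in 𝓝[>] (D.pos v), D.height q x < D.height p x := by
  have h1 : D.pos v < D.pos (G.tgt e) := hev ▸ D.pos_src_lt e
  have h2 : D.pos v < D.pos (G.tgt f) := hfv ▸ D.pos_src_lt f
  filter_upwards [h, Ioo_mem_nhdsGT h1, Ioo_mem_nhdsGT h2] with x hx hxe hxf
  have hxe' : x ∈ Icc (D.pos (G.src e)) (D.pos (G.tgt e)) := hev.symm ▸ ⟨hxe.1.le, hxe.2.le⟩
  have hxf' : x ∈ Icc (D.pos (G.src f)) (D.pos (G.tgt f)) := hfv.symm ▸ ⟨hxf.1.le, hxf.2.le⟩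
  rwa [D.height_eq_ext hp he hxe', D.height_eq_ext hq hf hxf', D.ext_of_mem hxe',
    D.ext_of_mem hxf']

theorem AboveIn.height_lt {u₁ u₂ v₁ v₂ v : Fin (n + 2)} {p q : List E} (hp : G.IsPath u₁ v₁ p)
    (hq : G.IsPath u₂ v₂ q) {e f : E} (he : e ∈ p) (hf : f ∈ q) (hev : G.tgt e = v)
    (hfv : G.tgt f = v) (h : D.AboveIn v e f) :
    ∀ᶠ x in 𝓝[<] (D.pos v), D.height q x < D.height p x := by
  have h1 : D.pos (G.src e) < D.pos v := hev ▸ D.pos_src_lt e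
  have h2 : D.pos (G.src f) < D.pos v := hfv ▸ D.pos_src_lt f
  filter_upwards [h, Ioo_mem_nhdsLT h1, Ioo_mem_nhdsLT h2] with x hx hxe hxf
  have hxe' : x ∈ Icc (D.pos (G.src e)) (D.pos (G.tgt e)) := hev.symm ▸ ⟨hxe.1.le, hxe.2.le⟩
  have hxf' : x ∈ Icc (D.pos (G.src f)) (D.pos (G.tgt f)) := hfv.symm ▸ ⟨hxf.1.le, hxf.2.le⟩
  rwa [D.height_eq_ext hp he hxe', D.height_eq_ext hq hf hxf', D.ext_of_mem hxe',
    D.ext_of_mem hxf']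

/-- With equal ends neither path is a proper suffix of the other, so distinct paths have distinct
merging edges. If that of `b` arrived on top, `b` would be higher than `a` just before the merging
vertex. -/
theorem inLE_of_height_le {u v : Fin (n + 2)} {a b : List E} (ha : G.IsPath u v a)
    (hb : G.IsPath u v b) (h : ∀ x ≤ D.pos v, D.height b x ≤ D.height a x) :
    D.planarFraming.InLE a b := by
  have suffix : ∀ a r : List E, G.IsPath u v a → G.IsPath u v (r ++ a) → r = [] := by
    intro a r ha hr
    obtain ⟨w, h1, h2⟩ := isPath_append.1 hr
    rcases eq_or_ne a [] with rfl | hne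
    · obtain rfl : u = v := ha
      simpa using hr.eq_nil
    · obtain rfl := ha.source_unique h2 hne
      exact h1.eq_nil
  rcases a.eq_or_suffix_or_merge b with
    hab | ⟨r, hr, rfl⟩ | ⟨r, hr, rfl⟩ | ⟨s, e, f, a', b', hne, rfl, rfl⟩
  · exact Or.inl hab
  · exact absurd (suffix _ _ hb ha) hr
  · exact absurd (suffix _ _ ha hb) hr
  · obtain ⟨w₁, -, -, h1⟩ := isPath_append.1 ha
    obtain ⟨w₂, -, -, h2⟩ := isPath_append.1 hb
    have hef : G.tgt e = G.tgt f := by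
      rcases eq_or_ne s [] with rfl | hs
      · exact Eq.trans h1 (Eq.symm h2)
      · exact h1.source_unique h2 hs
    refine Or.inr ⟨a', b', s, e, f, rfl, rfl, hef, ?_⟩
    rcases D.aboveIn_total rfl hef.symm hne with h' | h'
    · exact h'
    · obtain ⟨x, hx, hx'⟩ := ((h'.height_lt hb ha (by simp) (by simp) hef.symm rfl).and
        self_mem_nhdsWithin).exists
      exact absurd hx (h x (le_trans (le_of_lt hx') (D.pos_strictMono.monotone h1.le))).not_gt

theorem outLE_of_height_le {u v : Fin (n + 2)} {a b : List E} (ha : G.IsPath u v a)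
    (hb : G.IsPath u v b) (h : ∀ x, D.pos u ≤ x → D.height b x ≤ D.height a x) :
    D.planarFraming.OutLE a b := by
  have pre : ∀ a r : List E, G.IsPath u v a → G.IsPath u v (a ++ r) → r = [] := by
    intro a r ha hr
    obtain ⟨w, h1, h2⟩ := isPath_append.1 hr
    obtain rfl := ha.target_unique h1
    exact h2.eq_nil
  rcases a.eq_or_prefix_or_branch b with
    hab | ⟨r, hr, rfl⟩ | ⟨r, hr, rfl⟩ | ⟨s, e, f, a', b', hne, rfl, rfl⟩
  · exact Or.inl hab
  · exact absurd (pre _ _ hb ha) hr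
  · exact absurd (pre _ _ ha hb) hr
  · obtain ⟨w₁, h1, h3, -⟩ := isPath_append.1 ha
    obtain ⟨w₂, h2, h4, -⟩ := isPath_append.1 hb
    obtain rfl := h1.target_unique h2
    have hef : G.src e = G.src f := h3.trans h4.symm
    refine Or.inr ⟨a', b', s, e, f, rfl, rfl, hef, ?_⟩
    rcases D.aboveOut_total rfl hef.symm hne with h' | h'
    · exact h'
    · obtain ⟨x, hx, hx'⟩ := ((h'.height_lt hb ha (by simp) (by simp) hef.symm rfl).and
        self_mem_nhdsWithin).exists
      exact absurd hx (h x (le_trans (D.pos_strictMono.monotone (h3 ▸ h1.le))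
        (le_of_lt hx'))).not_gt

theorem height_left {u v w : Fin (n + 2)} {a b : List E} (_ : G.IsPath u v a)
    (hb : G.IsPath v w b) {x : ℝ} (hx : x ≤ D.pos v) : D.height (a ++ b) x = D.height a x := by
  rw [height_append, D.height_of_le hb hx, add_zero]

theorem height_right {u v w : Fin (n + 2)} {a b : List E} (ha : G.IsPath u v a)
    (_ : G.IsPath v w b) {x : ℝ} (hx : D.pos v ≤ x) : D.height (a ++ b) x = D.height b x := by
  rw [height_append, D.height_of_ge ha hx, zero_add]

theorem coherent_comm {φ : G.Framing} {p q : List E} (h : φ.Coherent p q) : φ.Coherent q p :=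
  fun v hv p₁ p₂ q₁ q₂ hp hq h1 h2 h3 h4 => (h v hv q₁ q₂ p₁ p₂ hq hp h3 h4 h1 h2).symm

theorem coherent_of_height_le {p q : List E} (h : ∀ x, D.height q x ≤ D.height p x) :
    D.planarFraming.Coherent p q := by
  rintro v - p₁ p₂ q₁ q₂ rfl rfl h1 h2 h3 h4
  refine Or.inl ⟨inLE_of_height_le h1 h3 fun x hx => ?_, outLE_of_height_le h2 h4 fun x hx => ?_⟩
  · simpa only [height_left h1 h2 hx, height_left h3 h4 hx] using h x
  · simpa only [height_right h1 h2 hx, height_right h3 h4 hx] using h x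

/-! ### Common vertices and crossings of two routes -/

/-- The route `p` passes through the vertex `v`. -/
def Passes (G : FlowGraph n E) (p : List E) (v : Fin (n + 2)) : Prop :=
  ∃ p₁ p₂, p = p₁ ++ p₂ ∧ G.IsPath 0 v p₁ ∧ G.IsPath v (Fin.last (n + 1)) p₂

theorem passes_src {p : List E} (hp : G.IsRoute p) {e : E} (he : e ∈ p) :
    Passes G p (G.src e) := by
  obtain ⟨p', q', rfl⟩ := List.append_of_mem he
  obtain ⟨w, h1, h2⟩ := isPath_append.1 hp
  exact ⟨p', e :: q', rfl, h2.1 ▸ h1, rfl, h2.2⟩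

theorem passes_tgt {p : List E} (hp : G.IsRoute p) {e : E} (he : e ∈ p) :
    Passes G p (G.tgt e) := by
  obtain ⟨p', q', rfl⟩ := List.append_of_mem he
  obtain ⟨w, h1, h2⟩ := isPath_append.1 hp
  exact ⟨p' ++ [e], q', by simp, isPath_append.2 ⟨w, h1, h2.1, rfl⟩, h2.2⟩

theorem passes_last {p : List E} (hp : G.IsRoute p) : Passes G p (Fin.last (n + 1)) :=
  ⟨p, [], by simp, hp, rfl⟩

theorem Passes.height_eq_zero {p : List E} {v : Fin (n + 2)} (h : Passes G p v) :
    D.height p (D.pos v) = 0 := by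
  obtain ⟨p₁, p₂, rfl, h1, h2⟩ := h
  rw [height_left h1 h2 le_rfl, D.height_of_ge h1 le_rfl]

/-- An edge of a route which reaches beyond a vertex of the route starts at that vertex with the
next edge, or later. -/
theorem eq_or_lt_src {v : Fin (n + 2)} {p₁ p₂ : List E} {e g : E} (h1 : G.IsPath 0 v p₁)
    (h2 : G.IsPath v (Fin.last (n + 1)) (e :: p₂)) (hg : g ∈ p₁ ++ e :: p₂) {t : ℝ}
    (ht : D.pos v < t) (htg : t ≤ D.pos (G.tgt g)) : g = e ∨ v < G.src g := by
  rcases List.mem_append.1 hg with h | h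
  · exact absurd (htg.trans (D.pos_strictMono.monotone (h1.tgt_le h))) ht.not_ge
  · rcases List.mem_cons.1 h with h | h
    · exact Or.inl h
    · exact Or.inr ((h2.1 ▸ G.src_lt_tgt e).trans_le (h2.2.le_src h))

/-- Routes do not meet between consecutive common vertices at the first of which they part. -/
theorem height_ne_of_consecutive {p q p₁ p₂ q₁ q₂ : List E} {e f : E} {v w : Fin (n + 2)}
    (hp : G.IsRoute p) (hq : G.IsRoute q) (hpe : p = p₁ ++ e :: p₂) (hqf : q = q₁ ++ f :: q₂)
    (h1 : G.IsPath 0 v p₁) (h2 : G.IsPath v (Fin.last (n + 1)) (e :: p₂))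
    (h3 : G.IsPath 0 v q₁) (h4 : G.IsPath v (Fin.last (n + 1)) (f :: q₂)) (hef : e ≠ f)
    (hw : ∀ u, v < u → Passes G p u → Passes G q u → w ≤ u) {t : ℝ}
    (ht : t ∈ Ioo (D.pos v) (D.pos w)) : D.height p t ≠ D.height q t := by
  intro heq
  -- A common edge over `t` is not both `e` and `f`, so it starts after `v`, at a common vertex
  -- before `t` and hence before `w`.
  have common : ∀ g, g ∈ p → g ∈ q → t ∉ D.span g := by
    intro g hgp hgq htg
    have h5 := eq_or_lt_src (D := D) h1 h2 (hpe ▸ hgp) ht.1 htg.2.le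
    have h6 := eq_or_lt_src (D := D) h3 h4 (hqf ▸ hgq) ht.1 htg.2.le
    have hlt : v < G.src g := by
      rcases h5 with rfl | h5
      · rcases h6 with rfl | h6
        · exact absurd rfl hef
        · exact h6
      · exact h5
    have := D.pos_strictMono.monotone (hw _ hlt (passes_src hp hgp) (passes_src hq hgq))
    exact (ht.2.trans_le this).not_gt htg.1
  -- A meeting point inside an edge of one route would put this edge on both routes, so the meeting
  -- point is a vertex.
  have vertex : ∀ r r', G.IsRoute r → G.IsRoute r' → D.height r t = D.height r' t →
      (∀ g, g ∈ r → g ∈ r' → t ∉ D.span g) → ∃ u, t = D.pos u ∧ Passes G r u := by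
    intro r r' hr hr' heq hc
    obtain ⟨g, hg, htg⟩ := D.exists_mem_Icc_of_isRoute hr
      ⟨(D.pos_strictMono.monotone (Fin.zero_le v)).trans_lt ht.1,
        ht.2.trans_le (D.pos_strictMono.monotone (Fin.le_last w))⟩
    rcases htg.1.eq_or_lt with h5 | h5
    · exact ⟨_, h5.symm, passes_src hr hg⟩
    rcases htg.2.eq_or_lt with h6 | h6
    · exact ⟨_, h6, passes_tgt hr hg⟩
    have hs : t ∈ D.span g := ⟨h5, h6⟩
    exact absurd hs (hc g hg ((D.height_eq_iff hr' hs).1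
      (heq.symm.trans ((D.height_eq_iff hr hs).2 hg))))
  obtain ⟨u, hu, hpu⟩ := vertex p q hp hq heq common
  obtain ⟨u', hu', hqu⟩ := vertex q p hq hp heq.symm fun g h h' => common g h' h
  obtain rfl := D.pos_strictMono.injective (hu.symm.trans hu')
  rw [hu] at ht
  exact (D.pos_strictMono.lt_iff_lt.1 ht.2).not_ge (hw u (D.pos_strictMono.lt_iff_lt.1 ht.1) hpu hqu)

/-- If `p` is not everywhere weakly below `q`, there is a first vertex after which it gets above
`q`. -/
theorem exists_parting {p q : List E} (hp : G.IsRoute p) (hq : G.IsRoute q)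
    (hpq : ¬ ∀ x, D.height p x ≤ D.height q x) :
    ∃ v p₁ e p₂ q₁ f q₂, p = p₁ ++ e :: p₂ ∧ q = q₁ ++ f :: q₂ ∧ G.IsPath 0 v p₁ ∧
      G.IsPath v (Fin.last (n + 1)) (e :: p₂) ∧ G.IsPath 0 v q₁ ∧
      G.IsPath v (Fin.last (n + 1)) (f :: q₂) ∧ e ≠ f ∧ D.AboveOut v e f ∧
      ∀ x ≤ D.pos v, D.height p x ≤ D.height q x := by
  -- The parting vertex is the last common vertex up to which `p` is weakly below `q`. The next
  -- edges differ there, since a common next edge would lead to a later such vertex.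
  let A : Set (Fin (n + 2)) := {u | Passes G p u ∧ Passes G q u ∧
    ∀ x ≤ D.pos u, D.height p x ≤ D.height q x}
  obtain ⟨v, ⟨⟨p₁, p₂', hpe, h1, h2⟩, ⟨q₁, q₂', hqf, h3, h4⟩, hv⟩, hmax⟩ :=
    A.exists_max_image id (toFinite A) ⟨0, ⟨[], p, rfl, rfl, hp⟩, ⟨[], q, rfl, rfl, hq⟩,
      fun x hx => by rw [D.height_of_le hp hx, D.height_of_le hq hx]⟩
  have hvl : v ≠ Fin.last (n + 1) := by
    rintro rfl
    refine hpq fun x => ?_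
    rcases le_total x (D.pos (Fin.last (n + 1))) with h | h
    · exact hv x h
    · rw [D.height_of_ge hp h, D.height_of_ge hq h]
  rcases p₂' with _ | ⟨e, p₂⟩
  · exact absurd h2 hvl
  rcases q₂' with _ | ⟨f, q₂⟩
  · exact absurd h4 hvl
  have hep : e ∈ p := by simp [hpe]
  have hfq : f ∈ q := by simp [hqf]
  have hef : e ≠ f := by
    rintro rfl
    have : G.tgt e ≤ v := hmax _ ⟨passes_tgt hp hep, passes_tgt hq hfq, fun x hx => by
      rcases le_total x (D.pos v) with h | h
      · exact hv x h
      · rw [← h2.1] at h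
        rw [D.height_eq_ext hp hep ⟨h, hx⟩, D.height_eq_ext hq hfq ⟨h, hx⟩]⟩
    exact this.not_gt (h2.1 ▸ G.src_lt_tgt e)
  refine ⟨v, p₁, e, p₂, q₁, f, q₂, hpe, hqf, h1, h2, h3, h4, hef, ?_, hv⟩
  rcases D.aboveOut_total h2.1 h4.1 hef with h | h
  · exact h
  exfalso
  -- If `q` left on top, then up to the next common vertex `w` the routes would not meet and `p`
  -- would stay below, so `w` would contradict the maximality of `v`.
  let B : Set (Fin (n + 2)) := {u | v < u ∧ Passes G p u ∧ Passes G q u}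
  obtain ⟨w, ⟨hvw, hpw, hqw⟩, hmin⟩ := B.exists_min_image id (toFinite B)
    ⟨Fin.last (n + 1), lt_of_le_of_ne (Fin.le_last v) hvl, passes_last hp, passes_last hq⟩
  have hne : ∀ t ∈ Ioo (D.pos v) (D.pos w), D.height p t ≠ D.height q t := fun t ht =>
    height_ne_of_consecutive hp hq hpe hqf h1 h2 h3 h4 hef
      (fun u hu hpu hqu => hmin u ⟨hu, hpu, hqu⟩) ht
  have hlt : ∀ t ∈ Ioo (D.pos v) (D.pos w), D.height p t < D.height q t := by
    rcases lt_or_lt_of_ne (D.continuous_height p).continuousOn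
      (D.continuous_height q).continuousOn hne with h' | h'
    · exact h'
    · obtain ⟨x, hx, hx'⟩ := ((h.height_lt hq hp hfq hep h4.1 h2.1).and
        (Ioo_mem_nhdsGT (D.pos_strictMono hvw))).exists
      exact absurd hx (h' x hx').not_gt
  have : w ≤ v := hmax w ⟨hpw, hqw, fun x hx => by
    rcases le_or_gt x (D.pos v) with h | h
    · exact hv x h
    · rcases hx.eq_or_lt with rfl | h'
      · rw [hpw.height_eq_zero, hqw.height_eq_zero]
      · exact (hlt x ⟨h, h'⟩).le⟩
  exact this.not_gt hvw

/-- Routes are coherent for the planar framing if and only if one of them is weakly below the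
other. -/
theorem coherent_iff {p q : List E} (hp : G.IsRoute p) (hq : G.IsRoute q) :
    D.planarFraming.Coherent p q ↔
      (∀ x, D.height q x ≤ D.height p x) ∨ ∀ x, D.height p x ≤ D.height q x := by
  refine ⟨fun hc => ?_, fun h => h.elim coherent_of_height_le fun h =>
    coherent_comm (coherent_of_height_le h)⟩
  -- A crossing violates coherence at `v`: before `v` the route `p` is weakly below `q`, and
  -- strictly so just after `v'`, while after `v` it leaves on top.
  have key : ∀ p q, G.IsRoute p → G.IsRoute q → D.planarFraming.Coherent p q →
      ∀ v p₁ e p₂ q₁ f q₂, p = p₁ ++ e :: p₂ → q = q₁ ++ f :: q₂ → G.IsPath 0 v p₁ →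
      G.IsPath v (Fin.last (n + 1)) (e :: p₂) → G.IsPath 0 v q₁ →
      G.IsPath v (Fin.last (n + 1)) (f :: q₂) → e ≠ f → D.AboveOut v e f →
      (∀ x ≤ D.pos v, D.height p x ≤ D.height q x) → ∀ v' < v,
      ¬ ∀ᶠ x in 𝓝[>] (D.pos v'), D.height p x < D.height q x := by
    intro p q hp hq hc v p₁ e p₂ q₁ f q₂ hpe hqf h1 h2 h3 h4 hef hab hle v' hv' hev
    have hin : G.IsInner v := ⟨((Fin.zero_le v').trans_lt hv').ne', by
      rintro rfl
      simpa using h2.eq_nil⟩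
    rcases hc v hin _ _ _ _ hpe hqf h1 h2 h3 h4 with ⟨h | h, -⟩ | ⟨-, h | h⟩
    · obtain ⟨x, hx, hx'⟩ := (hev.and (Ioo_mem_nhdsGT (D.pos_strictMono hv'))).exists
      rw [hpe, hqf, height_left h1 h2 hx'.2.le, height_left h3 h4 hx'.2.le, h] at hx
      exact hx.false
    · obtain ⟨p', q', s, g, g', hg, hg', htgt, hg''⟩ := h
      have hgp : g ∈ p := by simp [hpe, hg]
      have hgq : g' ∈ q := by simp [hqf, hg']
      obtain ⟨x, hx, hx'⟩ := ((AboveIn.height_lt hp hq hgp hgq rfl htgt.symm hg'').and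
        self_mem_nhdsWithin).exists
      have hgv : G.tgt g ≤ v := h1.tgt_le (by simp [hg])
      exact (hle x (le_trans (le_of_lt hx') (D.pos_strictMono.monotone hgv))).not_gt hx
    · exact hef (List.cons.inj h).1.symm
    · obtain ⟨p', q', s, g, g', hg, hg', -, hg''⟩ := h
      rcases s with _ | ⟨a, s⟩
      · obtain ⟨rfl, -⟩ := List.cons.inj hg
        obtain ⟨rfl, -⟩ := List.cons.inj hg'
        rw [h4.1] at hg''
        obtain ⟨x, hx, hx'⟩ := (hg''.and hab).exists
        exact lt_asymm hx hx'
      · exact hef ((List.cons.inj hg').1.trans (List.cons.inj hg).1.symm)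
  by_contra! hcon
  obtain ⟨hqp, hpq⟩ := hcon
  obtain ⟨v, p₁, e, p₂, q₁, f, q₂, hpe, hqf, h1, h2, h3, h4, hef, hab, hle⟩ :=
    exists_parting hp hq (by push Not; exact hpq)
  obtain ⟨v', q₁', f', q₂', p₁', e', p₂', hqf', hpe', h3', h4', h1', h2', hef', hab', hle'⟩ :=
    exists_parting hq hp (by push Not; exact hqp)
  have hev := hab.height_lt hp hq (by simp [hpe]) (by simp [hqf]) h2.1 h4.1
  have hev' := hab'.height_lt hq hp (by simp [hqf']) (by simp [hpe']) h4'.1 h2'.1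
  -- Each route gets above the other somewhere. At the later of the two parting vertices the routes
  -- cross; the vertices cannot coincide, as only one route leaves on top.
  rcases lt_trichotomy v v' with h | rfl | h
  · exact key q p hq hp (coherent_comm hc) v' q₁' f' q₂' p₁' e' p₂' hqf' hpe' h3' h4' h1' h2'
      hef' hab' hle' v h hev
  · obtain ⟨x, hx, hx'⟩ := (hev.and hev').exists
    exact lt_asymm hx hx'
  · exact key p q hp hq hc v p₁ e p₂ q₁ f q₂ hpe hqf h1 h2 h3 h4 hef hab hle v' h hev'

end FlowGraph.PlanarDrawing

namespace FlowGraph.PlanarDrawing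

variable {n : ℕ} {E : Type*} {G : FlowGraph n E} {D : G.PlanarDrawing}

/-! ### Comparison of the triangulations -/

/-- The flow through an edge is an affine function of the values at the regions. -/
theorem exists_affine_inverse [Finite E] (hG : G.Passable) (e : E) :
    ∃ (l : (D.BoundedRegion → ℝ) →ₗ[ℝ] ℝ) (k : ℝ), ∀ p, G.IsRoute p →
      G.routeFlow p e = l ((D.regionsAbove p).indicator 1) + k := by
  classical
  obtain ⟨p₀, hp₀, hep₀⟩ := hG.exists_route e
  -- The position of the point above `e` is a coordinate if that point is in a bounded region.
  -- Otherwise it is constantly 1: a route passing above the point, with the route `p₀` through `e`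
  -- below it, would make the region bounded. Dually, the point below `e` gives a coordinate or 0.
  have hup : ∃ (l : (D.BoundedRegion → ℝ) →ₗ[ℝ] ℝ) (k : ℝ), ∀ p, G.IsRoute p →
      (if D.Under p (D.upPoint e) then 1 else 0) = l ((D.regionsAbove p).indicator 1) + k := by
    by_cases h : ∃ A : D.BoundedRegion, D.upPoint e ∈ A.1
    · obtain ⟨A, hA⟩ := h
      refine ⟨LinearMap.proj A, 0, fun p hp => ?_⟩
      simp [indicator, mem_regionsAbove_iff hG hp hA]
    · refine ⟨0, 1, fun p hp => ?_⟩
      rw [if_pos]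
      · simp
      · by_contra hu
        exact h (exists_boundedRegion (D.upPoint_mem_free e) hp₀ hp (D.under_upPoint hp₀ hep₀) hu)
  have hdown : ∃ (l : (D.BoundedRegion → ℝ) →ₗ[ℝ] ℝ), ∀ p, G.IsRoute p →
      (if D.Under p (D.downPoint e) then 1 else 0) = l ((D.regionsAbove p).indicator 1) := by
    by_cases h : ∃ A : D.BoundedRegion, D.downPoint e ∈ A.1
    · obtain ⟨A, hA⟩ := h
      refine ⟨LinearMap.proj A, fun p hp => ?_⟩
      simp [indicator, mem_regionsAbove_iff hG hp hA]
    · refine ⟨0, fun p hp => ?_⟩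
      rw [if_neg]
      · simp
      · intro hd
        exact h (exists_boundedRegion (D.downPoint_mem_free e) hp hp₀ hd
          (D.not_under_downPoint hp₀ hep₀))
  obtain ⟨l, k, hl⟩ := hup
  obtain ⟨l', hl'⟩ := hdown
  refine ⟨l - l', k, fun p hp => ?_⟩
  have h1 := hl p hp
  have h2 := hl' p hp
  have h3 := D.under_upPoint_iff_or hp e
  have h4 : G.routeFlow p e =
      (if D.Under p (D.upPoint e) then 1 else 0) - if D.Under p (D.downPoint e) then 1 else 0 := by
    by_cases hep : e ∈ p
    · simp [h3, hep, routeFlow, D.not_under_downPoint hp hep]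
    · simp [h3, hep, routeFlow]
  rw [h4, h1, h2, LinearMap.sub_apply]
  ring

/-- The affine formula that recovers the flow through an edge holds at the route vertices, hence on
their convex hull. -/
theorem injOn_flowToOrder [Fintype E] (hG : G.Passable) (c : D.LowPaths) :
    InjOn (D.flowToOrder c) G.flowPolytope := by
  rw [flowPolytope_eq_convexHull]
  intro x hx y hy hxy
  funext e
  obtain ⟨l, k, h⟩ := exists_affine_inverse (D := D) hG e
  let L : (E → ℝ) →ₗ[ℝ] ℝ := LinearMap.proj e - l ∘ₗ D.flowToOrder c
  have hL : convexHull ℝ (G.routeFlow '' {p | G.IsRoute p}) ⊆ {z | L z = k} := by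
    refine convexHull_min ?_ (convex_hyperplane L.isLinear k)
    rintro _ ⟨p, hp, rfl⟩
    have := h p hp
    simp only [L, mem_ofPred_eq, LinearMap.sub_apply, LinearMap.proj_apply, LinearMap.comp_apply,
      flowToOrder_routeFlow hG c hp, this]
    ring
  have h1 := hL hx
  have h2 := hL hy
  simp only [L, mem_ofPred_eq, LinearMap.sub_apply, LinearMap.proj_apply,
    LinearMap.comp_apply, hxy] at h1 h2
  linarith

theorem image_convexHull_routeFlow [Finite E] (hG : G.Passable) (c : D.LowPaths)
    {C : Set (List E)} (hC : ∀ p ∈ C, G.IsRoute p) :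
    D.flowToOrder c '' convexHull ℝ (G.routeFlow '' C) =
      convexHull ℝ ((fun F => F.indicator (1 : D.BoundedRegion → ℝ)) '' (D.regionsAbove '' C)) := by
  rw [LinearMap.image_convexHull, image_image, image_image]
  congr 1
  exact image_congr fun p hp => flowToOrder_routeFlow hG c (hC p hp)

theorem bijOn_flowToOrder [Fintype E] (hG : G.Passable) (c : D.LowPaths) :
    BijOn (D.flowToOrder c) G.flowPolytope (orderPolytope D.BoundedRegion) := by
  have := BoundedRegion.finite (D := D) hG
  have h : D.flowToOrder c '' G.flowPolytope = orderPolytope D.BoundedRegion := by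
    rw [flowPolytope_eq_convexHull, image_convexHull_routeFlow hG c (C := {p | G.IsRoute p}) fun p hp => hp,
      orderPolytope_eq_convexHull (BoundedRegion.le_antisymm hG)]
    congr 2
    ext F
    constructor
    · rintro ⟨p, hp, rfl⟩
      exact isUpperSet_regionsAbove hG hp
    · intro hF
      obtain ⟨p, hp, hpF⟩ := exists_regionsAbove_eq hG hF
      exact ⟨p, hp, hpF⟩
  rw [← h]
  exact (injOn_flowToOrder hG c).bijOn_image

theorem isUpperChain_image [Finite E] (hG : G.Passable) {C : Set (List E)}
    (hC : D.planarFraming.IsClique C) : IsUpperChain (D.regionsAbove '' C) := by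
  constructor
  · rintro _ ⟨p, hp, rfl⟩
    exact isUpperSet_regionsAbove hG (hC.1 p hp)
  · rintro _ ⟨p, hp, rfl⟩ _ ⟨q, hq, rfl⟩ -
    have hp' := hC.1 p hp
    have hq' := hC.1 q hq
    exact ((coherent_iff hp' hq').1 (hC.2 p hp q hq)).imp
      (regionsAbove_subset_iff hG hp' hq').2 (regionsAbove_subset_iff hG hq' hp').2

/-- Taking all routes whose up-set is in the chain makes this a monotone section of the passage from
cliques to chains, without any need for a route to be determined by its up-set. -/
theorem isClique_preimage [Finite E] (hG : G.Passable) {C : Set (Set D.BoundedRegion)}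
    (hC : IsUpperChain C) : D.planarFraming.IsClique {p | G.IsRoute p ∧ D.regionsAbove p ∈ C} :=
  ⟨fun _ hp => hp.1, fun _ hp _ hq => (coherent_iff hp.1 hq.1).2 <|
    (hC.2.total hp.2 hq.2).imp (regionsAbove_subset_iff hG hp.1 hq.1).1
      (regionsAbove_subset_iff hG hq.1 hp.1).1⟩

theorem image_preimage_regionsAbove [Finite E] (hG : G.Passable) {C : Set (Set D.BoundedRegion)}
    (hC : IsUpperChain C) : D.regionsAbove '' {p | G.IsRoute p ∧ D.regionsAbove p ∈ C} = C := by
  ext F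
  constructor
  · rintro ⟨p, hp, rfl⟩
    exact hp.2
  · intro hF
    obtain ⟨p, hp, rfl⟩ := exists_regionsAbove_eq hG (hC.1 F hF)
    exact ⟨p, ⟨hp, hF⟩, rfl⟩

theorem image_dkkTriangulation [Fintype E] (hG : G.Passable) (c : D.LowPaths) :
    (fun s => D.flowToOrder c '' s) '' D.planarFraming.dkkTriangulation =
      canonicalTriangulation D.BoundedRegion := by
  have := BoundedRegion.finite (D := D) hG
  rw [canonicalTriangulation_eq (BoundedRegion.le_antisymm hG)]
  ext s
  constructor
  · rintro ⟨_, ⟨C, hC, hne, rfl⟩, rfl⟩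
    exact ⟨_, isUpperChain_image hG hC, hne.image _, image_convexHull_routeFlow hG c hC.1⟩
  · rintro ⟨C, hC, hne, rfl⟩
    have hcl := isClique_preimage hG hC
    have him := image_preimage_regionsAbove hG hC
    refine ⟨_, ⟨_, hcl, ?_, rfl⟩, ?_⟩
    · rw [← him] at hne
      exact hne.of_image
    · simp only [image_convexHull_routeFlow hG c hcl.1, him]

/-- The passages between cliques and chains are monotone in both directions. A chain that contains
the image of a maximal clique pulls back into that clique, and the image of a clique that contains
the preimage of a maximal chain stays in that chain. -/
theorem image_dkkTopSimplices [Fintype E] (hG : G.Passable) (c : D.LowPaths) :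
    (fun s => D.flowToOrder c '' s) '' D.planarFraming.dkkTopSimplices =
      canonicalTopSimplices D.BoundedRegion := by
  have := BoundedRegion.finite (D := D) hG
  rw [canonicalTopSimplices_eq (BoundedRegion.le_antisymm hG)]
  ext s
  constructor
  · rintro ⟨_, ⟨C, hC, rfl⟩, rfl⟩
    refine ⟨_, ⟨isUpperChain_image hG hC.1, fun C' hC' hle => ?_⟩,
      image_convexHull_routeFlow hG c hC.1.1⟩
    have hsub : {p | G.IsRoute p ∧ D.regionsAbove p ∈ C'} ⊆ C :=
      hC.2 (isClique_preimage hG hC') fun p hp => ⟨hC.1.1 p hp, hle ⟨p, hp, rfl⟩⟩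
    rw [← image_preimage_regionsAbove hG hC']
    exact image_mono hsub
  · rintro ⟨C, hC, rfl⟩
    have hcl := isClique_preimage hG hC.1
    have him := image_preimage_regionsAbove hG hC.1
    refine ⟨_, ⟨_, ⟨hcl, fun C' hC' hle p hp => ⟨hC'.1 p hp, ?_⟩⟩, rfl⟩, ?_⟩
    · exact hC.2 (isUpperChain_image hG hC') (by rw [← him]; exact image_mono hle) ⟨p, hp, rfl⟩
    · simp only [image_convexHull_routeFlow hG c hcl.1, him]

end FlowGraph.PlanarDrawing

theorem theorem2 {n : ℕ} {E : Type*} [Fintype E] (G : FlowGraph n E) (hG : G.Connected)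
    (hinner : ∀ v, G.IsInner v → (∃ e, G.tgt e = v) ∧ ∃ e, G.src e = v)
    (D : G.PlanarDrawing) :
    -- `P_G` is a finite poset
    Finite D.BoundedRegion ∧
    (∀ A B : D.BoundedRegion, A ≤ B → B ≤ A → A = B) ∧
    -- each bounded region can be reached from the low point
    Nonempty D.LowPaths ∧
    -- under the linear map given by any choice of dual paths, which identifies the flow polytope
    -- with the order polytope, the two triangulations coincide
    ∀ c : D.LowPaths,
      BijOn (D.flowToOrder c) G.flowPolytope (orderPolytope D.BoundedRegion) ∧
      (fun s => D.flowToOrder c '' s) '' D.planarFraming.dkkTopSimplices =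
        canonicalTopSimplices D.BoundedRegion ∧
      (fun s => D.flowToOrder c '' s) '' D.planarFraming.dkkTriangulation =
        canonicalTriangulation D.BoundedRegion := by
  have hP := hG.passable hinner
  exact ⟨FlowGraph.PlanarDrawing.BoundedRegion.finite hP,
    FlowGraph.PlanarDrawing.BoundedRegion.le_antisymm hP,
    FlowGraph.PlanarDrawing.nonempty_lowPaths hP, fun c =>
    ⟨FlowGraph.PlanarDrawing.bijOn_flowToOrder hP c,
      FlowGraph.PlanarDrawing.image_dkkTopSimplices hP c,
      FlowGraph.PlanarDrawing.image_dkkTriangulation hP c⟩⟩
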